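/- Let $n\ge 1$ be an integer, $\alpha>0$, $\beta>0$, and let $$D_n(t,\alpha,\beta)=\det\left(\int_0^1 x^{j+k}\,x^{\alpha}(1-x)^{\beta}e^{-t/x}\,dx\right)_{j,k=0}^{n-1},\qquad \operatorname{Re} t\ge 0,$$ be the Hankel determinant of the Pollaczek–Jacobi type weight. If $\alpha\notin\mathbb Z$, then $t\mapsto D_n(t,\alpha,\beta)$ has an analytic continuation to $|\arg t|<\pi$, again denoted $D_n(t,\alpha,\beta)$, and as $t\to 0$ in $|\arg t|<\pi$ $$D_n(t,\alpha,\beta)=D_n(0,\alpha,\beta)\left[A(t)+\frac{\Gamma(n+\alpha+1)\,\Gamma(n+1+\alpha+\beta)\,\pi\,t^{\alpha+1}}{\Gamma(\beta+1)\Gamma(\alpha+1)\Gamma(\alpha+2)^2\sin(\alpha\pi)\,(n-1)!\,\prod_{j=1}^{n-1}(\beta+j)}\,B(t)+O\!\left(t^{2(\alpha+1)}\right)\right],$$ where $t^{\alpha+1}$ is the principal branch and $A$, $B$ are analytic at $t=0$ with $$A(t)=1-\frac{n(n+\alpha+\beta)}{\alpha}\,t+\frac{n(n+\alpha+\beta)\,\bigl(n(n+\alpha+\beta)\alpha+\beta\bigr)}{2\alpha(\alpha^2-1)}\,t^2+O(t^3),\qquad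 B(t)=1+O(t).$$ Moreover, for all $\alpha,\beta>0$, $$D_n(0,\alpha,\beta)=4^{-n(n+\alpha+\beta)}(2\pi)^n\,\frac{\Gamma\left(\frac{\alpha+\beta+1}{2}\right)G^2\left(\frac{\alpha+\beta+1}{2}\right)G^2\left(\frac{\alpha+\beta}{2}+1\right)}{G(\alpha+\beta+1)\,G(\alpha+1)\,G(\beta+1)}\cdot\frac{G(n+1)\,G(n+\alpha+1)\,G(n+\beta+1)\,G(n+\alpha+\beta+1)}{G^2\left(n+\frac{\alpha+\beta+1}{2}\right)G^2\left(n+1+\frac{\alpha+\beta}{2}\right)\Gamma\left(n+\frac{\alpha+\beta+1}{2}\right)},$$ where $G$ is the Barnes $G$-function. -/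

import Mathlib

open Filter Topology Asymptotics

noncomputable section

/-- The Pollaczek-Jacobi type weight `x^α (1-x)^β e^{-t/x}` on `[0,1]`; the parameter `t` may be
complex. -/
def pjWeight (t : ℂ) (α β x : ℝ) : ℂ :=
  ((x ^ α * (1 - x) ^ β : ℝ) : ℂ) * Complex.exp (-t / (x : ℂ))

/-- The moment `μ_m(t) = ∫₀¹ x^m w(x; t, α, β) dx`. -/
def pjMoment (m : ℕ) (t : ℂ) (α β : ℝ) : ℂ :=
  ∫ x in (0 : ℝ)..1, (x : ℂ) ^ m * pjWeight t α β x

/-- The Hankel determinant `D_n(t, α, β) = det (μ_{j+k}(t))_{j,k=0}^{n-1}`. -/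
def hankelD (n : ℕ) (t : ℂ) (α β : ℝ) : ℂ :=
  Matrix.det (Matrix.of fun j k : Fin n => pjMoment ((j : ℕ) + (k : ℕ)) t α β)

/-- The Barnes `G`-function, through its Weierstrass product
`G(1+w) = (2π)^{w/2} exp(-(w + w²(1+γ))/2) ∏_{k≥1} (1 + w/k)^k exp(w²/(2k) - w)`. -/
def barnesG (z : ℂ) : ℂ :=
  (2 * (Real.pi : ℂ)) ^ ((z - 1) / 2)
    * Complex.exp (-((z - 1) + (z - 1) ^ 2 * (1 + (Real.eulerMascheroniConstant : ℂ))) / 2)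
    * ∏' k : ℕ, ((1 + (z - 1) / ((k : ℂ) + 1)) ^ (k + 1)
        * Complex.exp ((z - 1) ^ 2 / (2 * ((k : ℂ) + 1)) - (z - 1)))

/-- The coefficient of `t^{α+1}` in the expansion of `D_n(t, α, β) / D_n(0, α, β)`. -/
def nonanalyticCoeff (n : ℕ) (α β : ℝ) : ℝ :=
  Real.Gamma (n + α + 1) * Real.Gamma (n + 1 + α + β) * Real.pi /
    (Real.Gamma (β + 1) * Real.Gamma (α + 1) * Real.Gamma (α + 2) ^ 2 * Real.sin (α * Real.pi)
      * ((n - 1).factorial : ℝ) * ∏ j ∈ Finset.Icc 1 (n - 1), (β + (j : ℝ)))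

end

/-!
A moment is `pjInt β p t = ∫_0^1 x^(p-1) (1-x)^β e^{-t/x} dx` with `p = α + 1 + m`. Expanding
`(1-x)^β` in powers of `x` leaves incomplete Gamma integrals, so for non-integral `p` the moment is
an entire function of `t` plus `t^p` times another one. The Hankel matrix is therefore
`M(t) + t^(α+1) N(t)` with `M` and `N` entire. Expanding its determinant over the set of rows taken
from `N`, the empty set gives `A`, the singletons give `B`, and larger sets give the remainder.

The Taylor coefficients of `M` and `N` at `0` are Beta values and reciprocal Gamma values. Beta
determinants with arbitrary row parameters are Vandermonde determinants up to Gamma factors, and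
differentiating in `t` lowers a row parameter by one, which yields the coefficients of `A`. For
equally spaced parameters the product is Selberg's, and `G(z+1) = Γ(z) G(z)` together with the
duplication formula for `Γ` turns it into Barnes functions.
-/

noncomputable section

/-! ### The Barnes function -/

/-- The `k`-th factor of the Weierstrass product of `G(1 + w)`. -/
def barnesFactor (w : ℂ) (k : ℕ) : ℂ :=
  (1 + w / ((k : ℂ) + 1)) ^ (k + 1) * Complex.exp (w ^ 2 / (2 * ((k : ℂ) + 1)) - w)

/-- The principal logarithm of `barnesFactor w k`. -/
def logBarnesFactor (w : ℂ) (k : ℕ) : ℂ :=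
  ((k : ℂ) + 1) *
    (Complex.log (1 + w / ((k : ℂ) + 1)) - Complex.logTaylor 3 (w / ((k : ℂ) + 1)))

lemma one_add_div_natCast_add_one (w : ℂ) (k : ℕ) :
    1 + w / ((k : ℂ) + 1) = (w + 1 + k) / (k + 1) := by
  have := Nat.cast_add_one_ne_zero (R := ℂ) k
  field_simp
  ring

lemma exp_logBarnesFactor {w : ℂ} {k : ℕ} (hw : w + 1 + k ≠ 0) :
    Complex.exp (logBarnesFactor w k) = barnesFactor w k := by
  have hk := Nat.cast_add_one_ne_zero (R := ℂ) k
  have hne : 1 + w / ((k : ℂ) + 1) ≠ 0 := by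
    rw [one_add_div_natCast_add_one]
    exact div_ne_zero hw hk
  rw [barnesFactor, ← Complex.exp_log hne, ← Complex.exp_nat_mul, ← Complex.exp_add,
    logBarnesFactor]
  congr 1
  simp only [Complex.logTaylor, Finset.sum_range_succ, Finset.sum_range_zero]
  push_cast
  field_simp
  ring

lemma summable_logBarnesFactor (w : ℂ) : Summable (logBarnesFactor w) := by
  have hs : Summable fun k : ℕ => ‖w‖ ^ 3 * (1 / ((k + 1 : ℕ) : ℝ) ^ 2) :=
    ((summable_nat_add_iff 1).2 (Real.summable_one_div_nat_pow.2 one_lt_two)).mul_left _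
  refine Summable.of_norm_bounded_eventually_nat hs ?_
  obtain ⟨N, hN⟩ := exists_nat_gt (2 * ‖w‖)
  filter_upwards [eventually_ge_atTop N] with k hk
  have hk1 : (0 : ℝ) < (k : ℝ) + 1 := by positivity
  have hnorm : ‖((k : ℂ) + 1)‖ = (k : ℝ) + 1 := by exact_mod_cast Complex.norm_natCast (k + 1)
  have hx : ‖w / ((k : ℂ) + 1)‖ ≤ 1 / 2 := by
    have hkN : (N : ℝ) ≤ k := by exact_mod_cast hk
    rw [norm_div, hnorm, div_le_iff₀ hk1]
    linarith
  have hinv : (1 - ‖w / ((k : ℂ) + 1)‖)⁻¹ ≤ 2 := inv_le_of_inv_le₀ two_pos (by linarith)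
  calc ‖logBarnesFactor w k‖
      ≤ (k + 1) * (‖w / ((k : ℂ) + 1)‖ ^ 3 * (1 - ‖w / ((k : ℂ) + 1)‖)⁻¹ / 3) := by
        rw [logBarnesFactor, norm_mul, hnorm]
        gcongr
        exact (Complex.norm_log_sub_logTaylor_le 2 (hx.trans_lt (by norm_num))).trans_eq
          (by norm_num)
    _ ≤ (k + 1) * (‖w / ((k : ℂ) + 1)‖ ^ 3 * 2 / 2) := by gcongr; norm_num
    _ = ‖w‖ ^ 3 * (1 / ((k + 1 : ℕ) : ℝ) ^ 2) := by
        rw [norm_div, hnorm]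
        push_cast
        field_simp

lemma hasProd_barnesFactor {w : ℂ} (hw : ∀ k : ℕ, w + 1 + k ≠ 0) :
    HasProd (barnesFactor w) (Complex.exp (∑' k, logBarnesFactor w k)) := by
  simpa only [Function.comp_def, exp_logBarnesFactor (hw _)] using
    (summable_logBarnesFactor w).hasSum.cexp

lemma barnesG_eq_mul_tprod (z : ℂ) :
    barnesG z = (2 * (Real.pi : ℂ)) ^ ((z - 1) / 2)
      * Complex.exp (-((z - 1) + (z - 1) ^ 2 * (1 + (Real.eulerMascheroniConstant : ℂ))) / 2)
      * ∏' k, barnesFactor (z - 1) k :=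
  rfl

lemma barnesG_ne_zero {z : ℂ} (hz : ∀ k : ℕ, z + k ≠ 0) : barnesG z ≠ 0 := by
  have hprod := hasProd_barnesFactor (w := z - 1) (by simpa using hz)
  rw [barnesG_eq_mul_tprod, hprod.tprod_eq]
  refine mul_ne_zero (mul_ne_zero ?_ (Complex.exp_ne_zero _)) (Complex.exp_ne_zero _)
  have : (2 * (Real.pi : ℂ)) ≠ 0 := by simp [Real.pi_ne_zero]
  simp [Complex.cpow_eq_zero_iff, this]

lemma barnesG_one : barnesG 1 = 1 := by
  simp [barnesG]

lemma barnesFactor_add_one_mul {w : ℂ} (k : ℕ) :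
    barnesFactor (w + 1) k * (w + 1 + k) ^ (k + 1) =
      (w + 1 + (k + 1)) ^ (k + 1) * Complex.exp ((w + 1 / 2) * ((k : ℂ) + 1)⁻¹ - 1) *
        barnesFactor w k := by
  have hk := Nat.cast_add_one_ne_zero (R := ℂ) k
  have hexp : (w + 1) ^ 2 / (2 * ((k : ℂ) + 1)) - (w + 1) =
      ((w + 1 / 2) * ((k : ℂ) + 1)⁻¹ - 1) + (w ^ 2 / (2 * ((k : ℂ) + 1)) - w) := by
    field_simp
    ring
  rw [barnesFactor, barnesFactor, one_add_div_natCast_add_one, one_add_div_natCast_add_one, hexp,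
    Complex.exp_add, div_pow, div_pow]
  ring

lemma prod_barnesFactor_add_one (w : ℂ) (N : ℕ) :
    (∏ k ∈ Finset.range N, barnesFactor (w + 1) k) * ∏ k ∈ Finset.range N, (w + 1 + (k : ℂ)) =
      (w + 1 + N) ^ N * Complex.exp ((w + 1 / 2) * ((harmonic N : ℚ) : ℂ) - N)
        * ∏ k ∈ Finset.range N, barnesFactor w k := by
  induction N with
  | zero => simp
  | succ N ih =>
    have hexp : (w + 1 / 2) * (((harmonic N + (↑(N + 1))⁻¹ : ℚ)) : ℂ) - ((N + 1 : ℕ) : ℂ) =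
        ((w + 1 / 2) * ((harmonic N : ℚ) : ℂ) - N) + ((w + 1 / 2) * ((N : ℂ) + 1)⁻¹ - 1) := by
      push_cast
      ring
    rw [Finset.prod_range_succ, Finset.prod_range_succ, Finset.prod_range_succ,
      mul_mul_mul_comm, ih, harmonic_succ, hexp, Complex.exp_add]
    push_cast
    linear_combination (Complex.exp ((w + 1 / 2) * ((harmonic N : ℚ) : ℂ) - N)
        * ∏ k ∈ Finset.range N, barnesFactor w k) * barnesFactor_add_one_mul (w := w) N

/-- The ratio of the `N`-th partial products of `G(z + 1)` and `G(z)`. -/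
def barnesRatio (z : ℂ) (N : ℕ) : ℂ :=
  (z + N) ^ N * Complex.exp ((z - 1 / 2) * ((harmonic N : ℚ) : ℂ) - N) /
    ∏ k ∈ Finset.range N, (z + (k : ℂ))

lemma sqrt_two_mul_stirlingSeq (N : ℕ) :
    ((√2 * Stirling.stirlingSeq N : ℝ) : ℂ) =
      N.factorial * Complex.exp N / ((√(N : ℝ) : ℝ) * (N : ℂ) ^ N) := by
  have : √2 * Stirling.stirlingSeq N = N.factorial * Real.exp N / (√(N : ℝ) * N ^ N) := by
    rw [Stirling.stirlingSeq, Real.sqrt_mul zero_le_two, div_pow, ← Real.exp_nat_mul, mul_one]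
    field_simp
  rw [this]
  push_cast
  rfl

lemma barnesRatio_eq_GammaSeq_mul {z : ℂ} (hz : ∀ k : ℕ, z + k ≠ 0) {N : ℕ} (hN : 1 ≤ N) :
    barnesRatio z N =
      Complex.GammaSeq z N * ((1 + z / N) ^ N * (1 + z / N)) *
        ((√2 * Stirling.stirlingSeq N : ℝ) : ℂ)⁻¹ *
        Complex.exp ((z - 1 / 2) * (((harmonic N : ℚ) : ℂ) - (Real.log N : ℝ))) := by
  have hN0 : (N : ℂ) ≠ 0 := by exact_mod_cast (by omega : N ≠ 0)
  have hpow : (N : ℂ) ^ z ≠ 0 := by simp [Complex.cpow_eq_zero_iff, hN0]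
  have hprod : ∏ k ∈ Finset.range N, (z + (k : ℂ)) ≠ 0 := Finset.prod_ne_zero_iff.2 fun k _ => hz k
  have hfac : (N.factorial : ℂ) ≠ 0 := by exact_mod_cast N.factorial_ne_zero
  have : ((√(N : ℝ) : ℝ) : ℂ) ≠ 0 := by
    exact_mod_cast (Real.sqrt_pos.2 (by exact_mod_cast hN : (0 : ℝ) < N)).ne'
  have hsq : ((√(N : ℝ) : ℝ) : ℂ) ^ 2 = N := by
    exact_mod_cast Real.sq_sqrt (Nat.cast_nonneg N)
  have hexp : Complex.exp ((z - 1 / 2) * (((harmonic N : ℚ) : ℂ) - (Real.log N : ℝ))) =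
      Complex.exp ((z - 1 / 2) * ((harmonic N : ℚ) : ℂ) - N) * Complex.exp N / (N : ℂ) ^ z *
        (√(N : ℝ) : ℝ) := by
    rw [← Real.exp_log (Real.sqrt_pos.2 (by exact_mod_cast hN)), Complex.cpow_def_of_ne_zero hN0,
      Complex.ofReal_exp, ← Complex.exp_add, ← Complex.exp_sub, ← Complex.exp_add,
      Real.log_sqrt (by positivity), Complex.ofReal_div, Complex.ofReal_log (by positivity)]
    congr 1
    push_cast
    ring
  have hlin : 1 + z / N = (z + N) / N := by field_simp; ring
  have hzN := hz N
  rw [barnesRatio, Complex.GammaSeq, Finset.prod_range_succ, hexp, sqrt_two_mul_stirlingSeq, hlin,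
    div_pow]
  field_simp
  rw [hsq]

lemma tendsto_barnesRatio {z : ℂ} (hz : ∀ k : ℕ, z + k ≠ 0) :
    Tendsto (barnesRatio z) atTop
      (𝓝 (Complex.Gamma z * (Complex.exp z * 1) * ((√2 * √Real.pi : ℝ) : ℂ)⁻¹ *
        Complex.exp ((z - 1 / 2) * Real.eulerMascheroniConstant))) := by
  have hlin : Tendsto (fun N : ℕ => 1 + z / N) atTop (𝓝 1) := by
    simpa using (tendsto_const_div_atTop_nhds_zero_nat z).const_add 1
  have hstirling : Tendsto (fun N => ((√2 * Stirling.stirlingSeq N : ℝ) : ℂ)) atTop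
      (𝓝 ((√2 * √Real.pi : ℝ) : ℂ)) :=
    (Complex.continuous_ofReal.tendsto _).comp
      (Stirling.tendsto_stirlingSeq_sqrt_pi.const_mul √2)
  have hne : ((√2 * √Real.pi : ℝ) : ℂ) ≠ 0 := by
    exact_mod_cast (by positivity : √2 * √Real.pi ≠ 0)
  have hharmonic : Tendsto (fun N : ℕ => ((harmonic N : ℚ) : ℂ) - (Real.log N : ℝ)) atTop
      (𝓝 (Real.eulerMascheroniConstant : ℂ)) := by
    simpa [Function.comp_def] using
      (Complex.continuous_ofReal.tendsto _).comp Real.tendsto_harmonic_sub_log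
  refine ((((Complex.GammaSeq_tendsto_Gamma z).mul
    ((Complex.tendsto_one_add_div_pow_exp z).mul hlin)).mul (hstirling.inv₀ hne)).mul
    ((Complex.continuous_exp.tendsto _).comp (hharmonic.const_mul (z - 1 / 2)))).congr' ?_
  filter_upwards [eventually_ge_atTop 1] with N hN
  exact (barnesRatio_eq_GammaSeq_mul hz hN).symm

lemma barnesG_add_one {z : ℂ} (hz : ∀ k : ℕ, z + k ≠ 0) :
    barnesG (z + 1) = Complex.Gamma z * barnesG z := by
  have hz1 (k : ℕ) : z + 1 + k ≠ 0 := by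
    simpa [add_assoc, add_comm, add_left_comm] using hz (k + 1)
  have hG := (hasProd_barnesFactor (w := z - 1) (by simpa using hz)).multipliable.hasProd
  have hG1 := (hasProd_barnesFactor hz1).multipliable.hasProd
  have hratio : ∏' k, barnesFactor z k = (∏' k, barnesFactor (z - 1) k) *
      (Complex.Gamma z * (Complex.exp z * 1) * ((√2 * √Real.pi : ℝ) : ℂ)⁻¹ *
        Complex.exp ((z - 1 / 2) * Real.eulerMascheroniConstant)) := by
    refine tendsto_nhds_unique hG1.tendsto_prod_nat
      ((hG.tendsto_prod_nat.mul (tendsto_barnesRatio hz)).congr fun N => ?_)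
    have hpartial := prod_barnesFactor_add_one (z - 1) N
    have hprod : ∏ k ∈ Finset.range N, (z + (k : ℂ)) ≠ 0 :=
      Finset.prod_ne_zero_iff.2 fun k _ => hz k
    rw [sub_add_cancel, show z - 1 + 1 / 2 = z - 1 / 2 by ring] at hpartial
    rw [barnesRatio, ← mul_div_assoc, div_eq_iff hprod, hpartial]
    ring
  have hsqrt : (2 * (Real.pi : ℂ)) ^ (1 / 2 : ℂ) = ((√2 * √Real.pi : ℝ) : ℂ) := by
    rw [← Real.sqrt_mul zero_le_two, Real.sqrt_eq_rpow, Complex.ofReal_cpow (by positivity)]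
    push_cast
    rfl
  have hne : ((√2 * √Real.pi : ℝ) : ℂ) ≠ 0 := by
    exact_mod_cast (by positivity : √2 * √Real.pi ≠ 0)
  have hexp : -((z - 1) + (z - 1) ^ 2 * (1 + (Real.eulerMascheroniConstant : ℂ))) / 2 =
      -(z + z ^ 2 * (1 + (Real.eulerMascheroniConstant : ℂ))) / 2 + z +
        (z - 1 / 2) * Real.eulerMascheroniConstant := by
    ring
  rw [barnesG_eq_mul_tprod, barnesG_eq_mul_tprod, add_sub_cancel_right, hratio, hexp,
    show z / 2 = (z - 1) / 2 + 1 / 2 by ring,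
    Complex.cpow_add _ _ (by simp [Real.pi_ne_zero]), hsqrt, Complex.exp_add, Complex.exp_add]
  field_simp

/-! ### Products of consecutive Gamma values -/

/-- The product `Γ(z) Γ(z + 1) ⋯ Γ(z + n - 1)`, which is `G(z + n) / G(z)` in terms of the
Barnes function. -/
def gammaProd (z : ℂ) (n : ℕ) : ℂ :=
  ∏ k ∈ Finset.range n, Complex.Gamma (z + k)

lemma gammaProd_zero (z : ℂ) : gammaProd z 0 = 1 := by
  simp [gammaProd]

lemma gammaProd_succ (z : ℂ) (n : ℕ) :
    gammaProd z (n + 1) = gammaProd z n * Complex.Gamma (z + n) :=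
  Finset.prod_range_succ _ n

lemma gammaProd_succ' (z : ℂ) (n : ℕ) :
    gammaProd z (n + 1) = Complex.Gamma z * gammaProd (z + 1) n := by
  rw [gammaProd, Finset.prod_range_succ', mul_comm, gammaProd]
  simp only [Nat.cast_zero, add_zero, Nat.cast_succ, add_assoc, add_comm (1 : ℂ)]

lemma gammaProd_add (z : ℂ) (m n : ℕ) :
    gammaProd z (m + n) = gammaProd z m * gammaProd (z + m) n := by
  rw [gammaProd, Finset.prod_range_add, gammaProd, gammaProd]
  simp only [Nat.cast_add, add_assoc]

lemma gammaProd_ne_zero {z : ℂ} (hz : ∀ k : ℕ, z + k ≠ 0) (n : ℕ) : gammaProd z n ≠ 0 :=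
  Finset.prod_ne_zero_iff.2 fun k _ => Complex.Gamma_ne_zero fun m hm =>
    hz (k + m) (by push_cast; linear_combination hm)

lemma barnesG_add_nat {z : ℂ} (hz : ∀ k : ℕ, z + k ≠ 0) (n : ℕ) :
    barnesG (z + n) = gammaProd z n * barnesG z := by
  induction n with
  | zero => simp [gammaProd_zero]
  | succ n ih =>
    have hzn (k : ℕ) : z + n + k ≠ 0 := by simpa [add_assoc] using hz (n + k)
    rw [Nat.cast_succ, ← add_assoc, barnesG_add_one hzn, ih, gammaProd_succ]
    ring

lemma gammaProd_eq_barnesG_div {z : ℂ} (hz : ∀ k : ℕ, z + k ≠ 0) (n : ℕ) :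
    gammaProd z n = barnesG (z + n) / barnesG z := by
  rw [barnesG_add_nat hz, mul_div_cancel_right₀ _ (barnesG_ne_zero hz)]

/-- Two instances of the duplication formula, at `z` and at `z + 1/2`. -/
lemma Gamma_two_mul_mul_Gamma_two_mul_add_one (z : ℂ) :
    Complex.Gamma (2 * z) * Complex.Gamma (2 * z + 1) * (2 * Real.pi) =
      2 * (2 : ℂ) ^ (4 * z - 1) *
        (Complex.Gamma z * Complex.Gamma (z + 1 / 2) ^ 2 * Complex.Gamma (z + 1)) := by
  have hpi : ((√Real.pi : ℝ) : ℂ) ^ 2 = Real.pi := by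
    exact_mod_cast Real.sq_sqrt Real.pi_pos.le
  have htwo : (2 : ℂ) ^ (1 - 2 * z) * (2 : ℂ) ^ (1 - 2 * (z + 1 / 2)) *
      (2 : ℂ) ^ (4 * z - 1) = 1 := by
    rw [← Complex.cpow_add _ _ two_ne_zero, ← Complex.cpow_add _ _ two_ne_zero]
    ring_nf
    exact Complex.cpow_zero 2
  have hdup := Complex.Gamma_mul_Gamma_add_half z
  have hdup' := Complex.Gamma_mul_Gamma_add_half (z + 1 / 2)
  rw [show z + 1 / 2 + 1 / 2 = z + 1 by ring] at hdup'
  rw [show 2 * z + 1 = 2 * (z + 1 / 2) by ring]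
  linear_combination -(2 * Complex.Gamma (2 * z) * Complex.Gamma (2 * (z + 1 / 2))) *
      (((√Real.pi : ℝ) : ℂ) ^ 2 * htwo + hpi) -
    2 * (2 : ℂ) ^ (4 * z - 1) * (Complex.Gamma (z + 1 / 2) * Complex.Gamma (z + 1)) * hdup -
    2 * (2 : ℂ) ^ (4 * z - 1) *
      (Complex.Gamma (2 * z) * (2 : ℂ) ^ (1 - 2 * z) * (√Real.pi : ℝ)) * hdup'

lemma four_cpow (w : ℂ) : (4 : ℂ) ^ w = (2 : ℂ) ^ (2 * w) := by
  have := Complex.natCast_cpow_natCast_mul 2 2 w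
  norm_num at this
  exact this.symm

lemma gammaProd_two_mul (s : ℂ) (n : ℕ) :
    gammaProd (s + 1) (2 * n) * (2 * Real.pi) ^ n =
      (4 : ℂ) ^ ((n : ℂ) * (n + s)) * gammaProd ((s + 1) / 2) n * gammaProd (s / 2 + 1) n ^ 2 *
        gammaProd ((s + 1) / 2 + 1) n := by
  induction n with
  | zero => simp [gammaProd_zero]
  | succ n ih =>
    set z : ℂ := (s + 1) / 2 + n with hz
    have hdup := Gamma_two_mul_mul_Gamma_two_mul_add_one z
    have hfour : (4 : ℂ) ^ (((n + 1 : ℕ) : ℂ) * ((n + 1 : ℕ) + s)) =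
        (4 : ℂ) ^ ((n : ℂ) * (n + s)) * ((2 : ℂ) ^ (1 + (4 * z - 1))) := by
      rw [four_cpow, four_cpow, ← Complex.cpow_add _ _ two_ne_zero, hz]
      congr 1
      push_cast
      ring
    rw [show 2 * (n + 1) = 2 * n + 1 + 1 by ring, gammaProd_succ, gammaProd_succ, gammaProd_succ,
      gammaProd_succ, gammaProd_succ, pow_succ, hfour,
      Complex.cpow_add _ _ two_ne_zero, Complex.cpow_one,
      show s + 1 + ((2 * n : ℕ) : ℂ) = 2 * z by rw [hz]; push_cast; ring,
      show s + 1 + ((2 * n + 1 : ℕ) : ℂ) = 2 * z + 1 by rw [hz]; push_cast; ring,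
      show s / 2 + 1 + (n : ℂ) = z + 1 / 2 by rw [hz]; ring,
      show (s + 1) / 2 + 1 + (n : ℂ) = z + 1 by rw [hz]; ring]
    linear_combination Complex.Gamma (2 * z) * Complex.Gamma (2 * z + 1) * (2 * Real.pi) * ih +
      (4 : ℂ) ^ ((n : ℂ) * (n + s)) * gammaProd ((s + 1) / 2) n * gammaProd (s / 2 + 1) n ^ 2 *
        gammaProd ((s + 1) / 2 + 1) n * hdup

/-- Selberg's value of the Hankel determinant of the weight `x^α (1-x)^β` on `[0,1]`. -/
def jacobiHankel (n : ℕ) (α β : ℂ) : ℂ :=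
  gammaProd 1 n * gammaProd (α + 1) n * gammaProd (β + 1) n / gammaProd (α + β + n + 1) n

lemma gammaProd_add_one {h : ℂ} (hh : ∀ k : ℕ, h + k ≠ 0) (n : ℕ) :
    gammaProd (h + 1) n = gammaProd h n * Complex.Gamma (h + n) / Complex.Gamma h := by
  have hne : Complex.Gamma h ≠ 0 := by
    simpa [gammaProd] using gammaProd_ne_zero hh 1
  rw [eq_div_iff hne, ← gammaProd_succ, gammaProd_succ', mul_comm]

lemma jacobiHankel_eq_gammaProd {α β : ℂ} (hαβ : ∀ k : ℕ, α + β + 1 + k ≠ 0) (n : ℕ) :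
    jacobiHankel n α β = (4 : ℂ) ^ (-((n : ℂ) * (n + α + β))) * (2 * (Real.pi : ℂ)) ^ n *
      (gammaProd 1 n * gammaProd (α + 1) n * gammaProd (β + 1) n * gammaProd (α + β + 1) n) /
      (gammaProd ((α + β + 1) / 2) n * gammaProd ((α + β) / 2 + 1) n ^ 2 *
        gammaProd ((α + β + 1) / 2 + 1) n) := by
  have hsplit : gammaProd (α + β + n + 1) n =
      gammaProd (α + β + 1) (2 * n) / gammaProd (α + β + 1) n := by
    rw [eq_div_iff (gammaProd_ne_zero hαβ n), two_mul, gammaProd_add, mul_comm,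
      show α + β + n + 1 = α + β + 1 + n by ring]
  have hpi : (2 * (Real.pi : ℂ)) ^ n ≠ 0 := pow_ne_zero _ (by simp [Real.pi_ne_zero])
  have hdup := eq_div_of_mul_eq hpi (gammaProd_two_mul (α + β) n)
  rw [jacobiHankel, hsplit, hdup, Complex.cpow_neg, ← add_assoc]
  simp only [div_eq_mul_inv, mul_inv, inv_inv]
  ring

lemma jacobiHankel_eq_barnesG {α β : ℂ} (hα : ∀ k : ℕ, α + 1 + k ≠ 0)
    (hβ : ∀ k : ℕ, β + 1 + k ≠ 0) (hαβ : ∀ k : ℕ, α + β + 1 + k ≠ 0) (n : ℕ) :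
    jacobiHankel n α β =
      (4 : ℂ) ^ (-((n : ℂ) * (n + α + β))) * (2 * (Real.pi : ℂ)) ^ n
        * (Complex.Gamma ((α + β + 1) / 2) * barnesG ((α + β + 1) / 2) ^ 2
            * barnesG ((α + β) / 2 + 1) ^ 2
          / (barnesG (α + β + 1) * barnesG (α + 1) * barnesG (β + 1)))
        * (barnesG (n + 1) * barnesG (n + α + 1) * barnesG (n + β + 1) * barnesG (n + α + β + 1)
          / (barnesG (n + (α + β + 1) / 2) ^ 2 * barnesG (n + 1 + (α + β) / 2) ^ 2
            * Complex.Gamma (n + (α + β + 1) / 2))) := by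
  have hone (k : ℕ) : (1 : ℂ) + k ≠ 0 := by
    rw [add_comm]
    exact k.cast_add_one_ne_zero
  have hhalf (k : ℕ) : (α + β + 1) / 2 + k ≠ 0 := fun h =>
    hαβ (2 * k) (by push_cast; linear_combination 2 * h)
  have hhalf' (k : ℕ) : (α + β) / 2 + 1 + k ≠ 0 := fun h =>
    hαβ (2 * k + 1) (by push_cast; linear_combination 2 * h)
  rw [jacobiHankel_eq_gammaProd hαβ, gammaProd_add_one hhalf, gammaProd_eq_barnesG_div hone,
    gammaProd_eq_barnesG_div hα, gammaProd_eq_barnesG_div hβ, gammaProd_eq_barnesG_div hαβ,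
    gammaProd_eq_barnesG_div hhalf, gammaProd_eq_barnesG_div hhalf', barnesG_one,
    add_comm (n : ℂ) 1, show (n : ℂ) + α + 1 = α + 1 + n by ring,
    show (n : ℂ) + β + 1 = β + 1 + n by ring,
    show (n : ℂ) + α + β + 1 = α + β + 1 + n by ring, add_comm (n : ℂ) ((α + β + 1) / 2),
    show 1 + (n : ℂ) + (α + β) / 2 = (α + β) / 2 + 1 + n by ring]
  simp only [div_eq_mul_inv, mul_inv, inv_inv, inv_pow, mul_pow]
  ring

/-! ### Determinants of Beta values -/

lemma det_eval_eq_vandermonde_mul {R : Type*} [CommRing R] {n : ℕ} (v : Fin n → R)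
    (p : Fin n → Polynomial R) (hp : ∀ j, (p j).natDegree < n) :
    (Matrix.of fun i j => (p j).eval (v i)).det =
      (Matrix.vandermonde v).det * (Matrix.of fun i j : Fin n => (p j).coeff i).det := by
  rw [← Matrix.det_mul]
  congr 1
  ext i j
  rw [Matrix.mul_apply, Matrix.of_apply, Polynomial.eval_eq_sum_range' (hp j),
    ← Fin.sum_univ_eq_sum_range (fun k => (p j).coeff k * v i ^ k)]
  exact Finset.sum_congr rfl fun k _ => by
    simp only [Matrix.vandermonde_apply, Matrix.of_apply, mul_comm]

section Pochhammer

variable {R : Type*} [CommRing R]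

/-- The polynomials `(X)_j (X + c + j)_{n-1-j}`, `j < n`, all of degree `n - 1`: the numerators of
the Beta values `B(x + j, c)` over their common denominator. -/
def pochPair (c : R) (n j : ℕ) : Polynomial R :=
  ascPochhammer R j * (ascPochhammer R (n - 1 - j)).comp (Polynomial.X + Polynomial.C (c + j))

lemma eval_pochPair (c : R) (n j : ℕ) (x : R) :
    (pochPair c n j).eval x =
      (ascPochhammer R j).eval x * (ascPochhammer R (n - 1 - j)).eval (x + (c + j)) := by
  simp [pochPair]

variable [IsDomain R] [CharZero R]

lemma natDegree_pochPair_lt (c : R) {n j : ℕ} (hj : j < n) : (pochPair c n j).natDegree < n := by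
  have : (pochPair c n j).natDegree ≤ j + (n - 1 - j) := by
    refine Polynomial.natDegree_mul_le.trans ?_
    rw [Polynomial.natDegree_comp, Polynomial.natDegree_X_add_C, ascPochhammer_natDegree,
      ascPochhammer_natDegree, mul_one]
  omega

/-- At the nodes `0, -1, -2, …` both the matrix of values of the polynomials and the matrix of
values of `(X)_j` are triangular; comparing the two determinants gives the coefficient
determinant. -/
lemma det_eval_pochPair (c : R) {n : ℕ} (v : Fin n → R) :
    (Matrix.of fun i j : Fin n => (pochPair c n j).eval (v i)).det =
      (Matrix.vandermonde v).det * ∏ k ∈ Finset.range n, (ascPochhammer R k).eval c := by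
  have hdeg (j : Fin n) := natDegree_pochPair_lt c j.2
  rw [det_eval_eq_vandermonde_mul v (fun j => pochPair c n j) hdeg]
  congr 1
  let node (i : Fin n) : R := -((i : ℕ) : R)
  have hvan : (Matrix.vandermonde node).det ≠ 0 :=
    Matrix.det_vandermonde_ne_zero_iff.2 fun i j h => by simpa [node, Fin.ext_iff] using h
  have hzero (i j : Fin n) (hij : i < j) : (ascPochhammer R j).eval (node i) = 0 :=
    ascPochhammer_eval_neg_coe_nat_of_lt hij
  have hmonic : (Matrix.vandermonde node).det = ∏ i : Fin n, (ascPochhammer R i).eval (node i) := by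
    rw [Matrix.det_eval_matrixOfPolynomials_eq_det_vandermonde node (fun j => ascPochhammer R j)
      (fun i => ascPochhammer_natDegree _ _) (fun i => monic_ascPochhammer _ _)]
    exact Matrix.det_of_isLowerTriangular (Matrix.of fun i j : Fin n => _) hzero
  have hpair : (Matrix.of fun i j : Fin n => (pochPair c n j).eval (node i)).det =
      ∏ i : Fin n, ((ascPochhammer R i).eval (node i) * (ascPochhammer R (n - 1 - i)).eval c) := by
    rw [Matrix.det_of_isLowerTriangular _ fun i j hij => by
      rw [Matrix.of_apply, eval_pochPair, hzero i j hij, zero_mul]]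
    refine Finset.prod_congr rfl fun i _ => ?_
    rw [Matrix.of_apply, eval_pochPair, show node i + (c + (i : ℕ)) = c by simp [node]]
  rw [det_eval_eq_vandermonde_mul node (fun j => pochPair c n j) hdeg, Finset.prod_mul_distrib,
    ← hmonic] at hpair
  rw [mul_left_cancel₀ hvan hpair,
    Fin.prod_univ_eq_prod_range (fun i => (ascPochhammer R (n - 1 - i)).eval c),
    Finset.prod_range_reflect (fun i => (ascPochhammer R i).eval c)]

end Pochhammer

lemma Gamma_add_nat {a : ℂ} (ha : ∀ m : ℕ, a + m ≠ 0) (j : ℕ) :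
    Complex.Gamma (a + j) = (ascPochhammer ℂ j).eval a * Complex.Gamma a := by
  have hpole (m : ℕ) : a ≠ -m := fun h => ha m (by rw [h, neg_add_cancel])
  rw [← Complex.Gamma_add_nat_div_Gamma_eq _ hpole,
    div_mul_cancel₀ _ (Complex.Gamma_ne_zero hpole)]

/-- Unlike `Gamma_add_nat` this also holds at the poles, where `Complex.Gamma` is zero. -/
lemma inv_Gamma_eq_mul_inv_Gamma_add_nat (a : ℂ) (j : ℕ) :
    (Complex.Gamma a)⁻¹ = (ascPochhammer ℂ j).eval a * (Complex.Gamma (a + j))⁻¹ := by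
  induction j with
  | zero => simp
  | succ j ih =>
    rw [ih, Complex.one_div_Gamma_eq_self_mul_one_div_Gamma_add_one (a + j),
      ascPochhammer_succ_eval, Nat.cast_succ, add_assoc]
    ring

/-- `Γ(a)Γ(c)/Γ(a+c)`, the Beta function continued meromorphically in both arguments. -/
def gammaBeta (a c : ℂ) : ℂ :=
  Complex.Gamma a * Complex.Gamma c / Complex.Gamma (a + c)

/-- The determinant of the matrix `B(a_i + j, c)` for an arbitrary sequence of row parameters. -/
def betaDet (n : ℕ) (c : ℂ) (a : Fin n → ℂ) : ℂ :=
  (Matrix.of fun i j : Fin n => gammaBeta (a i + (j : ℕ)) c).det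

lemma betaDet_eq {n : ℕ} (c : ℂ) {a : Fin n → ℂ} (ha : ∀ i, ∀ m : ℕ, a i + m ≠ 0) :
    betaDet n c a =
      (∏ i, (Complex.Gamma (a i) * Complex.Gamma c / Complex.Gamma (a i + c + (n - 1 : ℕ)))) *
        ((Matrix.vandermonde a).det * ∏ k ∈ Finset.range n, (ascPochhammer ℂ k).eval c) := by
  rw [← det_eval_pochPair, ← Matrix.det_mul_column, betaDet]
  congr 1
  ext i j
  have hj : ((j : ℕ) : ℂ) + ((n - 1 - j : ℕ) : ℂ) = ((n - 1 : ℕ) : ℂ) := by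
    rw [← Nat.cast_add]
    congr 1
    omega
  rw [Matrix.of_apply, gammaBeta, Gamma_add_nat (ha i), div_eq_mul_inv,
    inv_Gamma_eq_mul_inv_Gamma_add_nat _ (n - 1 - j), Matrix.of_apply, Matrix.of_apply,
    eval_pochPair, show a i + (j : ℕ) + c + ((n - 1 - j : ℕ) : ℂ) = a i + c + (n - 1 : ℕ) by
      rw [← hj]; ring, show a i + (j : ℕ) + c = a i + (c + (j : ℕ)) by ring]
  ring

lemma det_vandermonde_cons {R : Type*} [CommRing R] {n : ℕ} (x : R) (v : Fin n → R) :
    (Matrix.vandermonde (Fin.cons x v : Fin (n + 1) → R)).det =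
      (∏ j, (v j - x)) * (Matrix.vandermonde v).det := by
  rw [Matrix.det_vandermonde, Matrix.det_vandermonde, Fin.prod_univ_succ]
  simp only [Fin.prod_Ioi_zero, Fin.prod_Ioi_succ, Fin.cons_zero, Fin.cons_succ]

lemma betaDet_cons {n : ℕ} (c : ℂ) {x : ℂ} {v : Fin n → ℂ} (hx : ∀ m : ℕ, x + m ≠ 0)
    (hv : ∀ i, ∀ m : ℕ, v i + m ≠ 0) :
    betaDet (n + 1) c (Fin.cons x v) =
      Complex.Gamma x / Complex.Gamma (x + c + n) * (∏ j, (v j - x)) *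
      (Complex.Gamma c *
        (∏ i, (Complex.Gamma (v i) * Complex.Gamma c / Complex.Gamma (v i + c + n))) *
        ((Matrix.vandermonde v).det *
          ∏ k ∈ Finset.range (n + 1), (ascPochhammer ℂ k).eval c)) := by
  rw [betaDet_eq c (Fin.cases hx hv), Fin.prod_univ_succ, det_vandermonde_cons]
  simp only [Fin.cons_zero, Fin.cons_succ, Nat.add_sub_cancel]
  ring

lemma betaDet_cons_sub_nat {n m : ℕ} (c : ℂ) {x : ℂ} {v : Fin n → ℂ}
    (hx : ∀ k : ℕ, x - m + k ≠ 0) (hv : ∀ i, ∀ k : ℕ, v i + k ≠ 0) :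
    betaDet (n + 1) c (Fin.cons (x - m) v) * (∏ j, (v j - x)) * (ascPochhammer ℂ m).eval (x - m) =
      betaDet (n + 1) c (Fin.cons x v) * (∏ j, (v j - (x - m))) *
        (ascPochhammer ℂ m).eval (x - m + c + n) := by
  have hx' (k : ℕ) : x + k ≠ 0 := by
    simpa [← add_assoc] using hx (m + k)
  have hnum := Gamma_add_nat hx m
  have hden := inv_Gamma_eq_mul_inv_Gamma_add_nat (x - m + c + n) m
  rw [show x - m + c + n + m = x + c + n by ring] at hden
  rw [sub_add_cancel] at hnum
  rw [betaDet_cons c hx hv, betaDet_cons c hx' hv, div_eq_mul_inv, hden, hnum]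
  ring

/-- The arithmetic progression `x, x + 1, …, x + n - 1`, the row parameters of a Hankel matrix of
Beta values. -/
def arith {R : Type*} [Ring R] (x : R) (n : ℕ) (i : Fin n) : R := x + (i : ℕ)

lemma cons_arith {R : Type*} [Ring R] (x : R) (n : ℕ) :
    (Fin.cons x (arith (x + 1) n) : Fin (n + 1) → R) = arith x (n + 1) := by
  ext i
  refine Fin.cases ?_ (fun i => ?_) i
  · simp [arith]
  · simp only [arith, Fin.cons_succ, Fin.val_succ, Nat.cast_succ]
    abel

lemma arith_add_ne_zero {x : ℂ} (hx : ∀ m : ℕ, x + m ≠ 0) {n : ℕ} (i : Fin n) (m : ℕ) :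
    arith x n i + m ≠ 0 := by
  simpa [arith, add_assoc] using hx (i + m)

lemma prod_arith_sub (x : ℂ) (n m : ℕ) :
    ∏ j, (arith (x + 1) n j - (x - m)) = n.factorial * (m + n).choose n := by
  rw [← Nat.cast_mul, ← Nat.ascFactorial_eq_factorial_mul_choose, Nat.ascFactorial_eq_prod_range]
  simp only [arith]
  rw [Fin.prod_univ_eq_prod_range (fun j => x + 1 + (j : ℂ) - (x - m))]
  push_cast
  exact Finset.prod_congr rfl fun j _ => by ring

lemma prod_arith_sub_self (x : ℂ) (n : ℕ) : ∏ j, (arith (x + 1) n j - x) = n.factorial := by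
  simpa using prod_arith_sub x n 0

lemma det_vandermonde_arith (x : ℂ) (n : ℕ) :
    (Matrix.vandermonde (arith x n)).det = gammaProd 1 n := by
  induction n generalizing x with
  | zero => simp [gammaProd_zero]
  | succ n ih =>
    rw [← cons_arith, det_vandermonde_cons, ih, gammaProd_succ, add_comm 1 (n : ℂ),
      Complex.Gamma_nat_eq_factorial, prod_arith_sub_self, mul_comm]

lemma betaDet_arith (n : ℕ) {α β : ℂ} (hα : ∀ k : ℕ, α + 1 + k ≠ 0)
    (hβ : ∀ k : ℕ, β + 1 + k ≠ 0) :
    betaDet n (β + 1) (arith (α + 1) n) = jacobiHankel n α β := by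
  rw [betaDet_eq _ (arith_add_ne_zero hα), det_vandermonde_arith, jacobiHankel]
  simp only [arith]
  rw [Fin.prod_univ_eq_prod_range (fun i => Complex.Gamma (α + 1 + i) * Complex.Gamma (β + 1) /
    Complex.Gamma (α + 1 + i + (β + 1) + (n - 1 : ℕ))), Finset.prod_div_distrib,
    Finset.prod_mul_distrib]
  have hnum : gammaProd (β + 1) n = (∏ k ∈ Finset.range n, (ascPochhammer ℂ k).eval (β + 1)) *
      ∏ _k ∈ Finset.range n, Complex.Gamma (β + 1) := by
    rw [gammaProd, ← Finset.prod_mul_distrib]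
    exact Finset.prod_congr rfl fun k _ => Gamma_add_nat hβ k
  have hden : gammaProd (α + β + n + 1) n =
      ∏ k ∈ Finset.range n, Complex.Gamma (α + 1 + k + (β + 1) + (n - 1 : ℕ)) := by
    refine Finset.prod_congr rfl fun k hk => ?_
    rw [Nat.cast_sub (by grind)]
    congr 1
    push_cast
    ring
  rw [hnum, hden, gammaProd.eq_1 (α + 1), div_mul_eq_mul_div]
  congr 1
  rw [mul_comm (∏ k ∈ Finset.range n, (ascPochhammer ℂ k).eval (β + 1))]
  ring

lemma betaDet_cons_arith_lower (n m : ℕ) (c : ℂ) {y : ℂ} (hy : ∀ k : ℕ, y - m + k ≠ 0) :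
    betaDet (n + 1) c (Fin.cons (y - m) (arith (y + 1) n)) =
      betaDet (n + 1) c (arith y (n + 1)) *
        ((m + n).choose n * (ascPochhammer ℂ m).eval (y - m + c + n) /
          (ascPochhammer ℂ m).eval (y - m)) := by
  have hv (k : ℕ) : y + 1 + k ≠ 0 := by
    convert hy (m + 1 + k) using 1
    push_cast
    ring
  have hfac : (n.factorial : ℂ) ≠ 0 := Nat.cast_ne_zero.2 n.factorial_ne_zero
  have hpoch : (ascPochhammer ℂ m).eval (y - m) ≠ 0 :=
    fun h => by
      obtain ⟨k, _, hk⟩ := ascPochhammer_eval_eq_zero_iff m _ |>.1 h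
      exact hy k (by rw [hk]; ring)
  have h := betaDet_cons_sub_nat c hy (arith_add_ne_zero hv (n := n))
  rw [prod_arith_sub_self, prod_arith_sub, cons_arith] at h
  rw [← mul_div_assoc, eq_div_iff hpoch]
  exact mul_left_cancel₀ hfac (by linear_combination h)

lemma betaDet_cons_cons_swap {n : ℕ} (c x y : ℂ) (v : Fin n → ℂ) :
    betaDet (n + 2) c (Fin.cons y (Fin.cons x v)) =
      -betaDet (n + 2) c (Fin.cons x (Fin.cons y v)) := by
  have hswap : (Matrix.of fun i j : Fin (n + 2) =>
        gammaBeta ((Fin.cons y (Fin.cons x v) : Fin (n + 2) → ℂ) i + (j : ℕ)) c) =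
      (Matrix.of fun i j : Fin (n + 2) =>
        gammaBeta ((Fin.cons x (Fin.cons y v) : Fin (n + 2) → ℂ) i + (j : ℕ)) c).submatrix
        (Equiv.swap 0 1) id := by
    ext i j
    refine Fin.cases ?_ (Fin.cases ?_ fun i => ?_) i
    · simp
    · simp
    · have hi : Equiv.swap (0 : Fin (n + 2)) 1 i.succ.succ = i.succ.succ :=
        Equiv.swap_apply_of_ne_of_ne (Fin.succ_ne_zero _)
          fun h => Fin.succ_ne_zero i (Fin.succ_injective _ h)
      simp [hi]
  rw [betaDet, hswap, Matrix.det_permute, Equiv.Perm.sign_swap (by simp), betaDet]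
  simp

lemma betaDet_cons_cons_arith_lower (n : ℕ) (c : ℂ) {y : ℂ} (hy : ∀ k : ℕ, y - 1 + k ≠ 0) :
    betaDet (n + 2) c (Fin.cons (y - 1) (Fin.cons y (arith (y + 2) n))) =
      betaDet (n + 2) c (arith y (n + 2)) *
        ((2 + n).choose n * (ascPochhammer ℂ 2).eval (y + c + n) /
          (ascPochhammer ℂ 2).eval (y - 1)) := by
  have hfac : (n.factorial : ℂ) ≠ 0 := Nat.cast_ne_zero.2 n.factorial_ne_zero
  have hv (i : Fin (n + 1)) (k : ℕ) :
      (Fin.cons y (arith (y + 1 + 1) n) : Fin (n + 1) → ℂ) i + k ≠ 0 := by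
    refine Fin.cases ?_ (fun i => ?_) i
    · convert hy (1 + k) using 1
      push_cast
      simp only [Fin.cons_zero]
      ring
    · exact arith_add_ne_zero (fun m => by
        convert hy (m + 3) using 1
        push_cast
        ring) i k
  have hpoch : (ascPochhammer ℂ 2).eval (y - 1) ≠ 0 := by
    have h0 := hy 0
    have h1 := hy 1
    simp only [ascPochhammer_succ_eval, ascPochhammer_zero, Polynomial.eval_one, one_mul]
    exact mul_ne_zero h0 h1
  have hsub : y + 1 - ((2 : ℕ) : ℂ) = y - 1 := by push_cast; ring
  have h := betaDet_cons_sub_nat (n := n + 1) (m := 2) c (x := y + 1)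
    (fun k => by rw [hsub]; exact hy k) hv
  rw [Fin.prod_univ_succ, Fin.prod_univ_succ] at h
  simp only [Fin.cons_zero, Fin.cons_succ] at h
  rw [prod_arith_sub_self, prod_arith_sub, betaDet_cons_cons_swap c y (y + 1),
    cons_arith, cons_arith, hsub, show y - 1 + c + ((n + 1 : ℕ) : ℂ) = y + c + n by push_cast; ring,
    show y + 1 + 1 = y + 2 by ring] at h
  rw [← mul_div_assoc, eq_div_iff hpoch]
  exact mul_left_cancel₀ hfac (by linear_combination -h)

lemma jacobiHankel_ne_zero {α β : ℂ} (hα : ∀ k : ℕ, α + 1 + k ≠ 0)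
    (hβ : ∀ k : ℕ, β + 1 + k ≠ 0) {n : ℕ} (hαβ : ∀ k : ℕ, α + β + n + 1 + k ≠ 0) :
    jacobiHankel n α β ≠ 0 := by
  have hone (k : ℕ) : (1 : ℂ) + k ≠ 0 := by
    rw [add_comm]
    exact k.cast_add_one_ne_zero
  exact div_ne_zero (mul_ne_zero (mul_ne_zero (gammaProd_ne_zero hone n) (gammaProd_ne_zero hα n))
    (gammaProd_ne_zero hβ n)) (gammaProd_ne_zero hαβ n)

lemma jacobiHankel_add_two {α β : ℂ} (hα : ∀ k : ℕ, α + 1 + k ≠ 0)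
    (hβ : ∀ k : ℕ, β + 1 + k ≠ 0) {n : ℕ} (hαβ : ∀ k : ℕ, α + β + n + 2 + k ≠ 0) :
    jacobiHankel n (α + 2) β = jacobiHankel (n + 1) α β *
      (Complex.Gamma (α + n + 2) * Complex.Gamma (α + β + n + 2) /
        (n.factorial * Complex.Gamma (β + 1 + n) * Complex.Gamma (α + 1) *
          Complex.Gamma (α + 2))) := by
  have hGamma {z : ℂ} (hz : ∀ k : ℕ, z + k ≠ 0) : Complex.Gamma z ≠ 0 := by
    simpa [gammaProd] using gammaProd_ne_zero hz 1
  have hα1 := hGamma hα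
  have hα2 : Complex.Gamma (α + 2) ≠ 0 := hGamma fun k => by
    convert hα (k + 1) using 1
    push_cast
    ring
  have hβn : Complex.Gamma (β + 1 + n) ≠ 0 := hGamma fun k => by
    simpa [add_assoc] using hβ (n + k)
  have hαβ0 := hGamma hαβ
  have hαβ1 := gammaProd_ne_zero (z := α + β + n + 2 + 1) (fun k => by
    convert hαβ (k + 1) using 1
    push_cast
    ring) n
  have hfac : (n.factorial : ℂ) ≠ 0 := Nat.cast_ne_zero.2 n.factorial_ne_zero
  have hraise : gammaProd (α + 1) (n + 1) * Complex.Gamma (α + n + 2) =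
      Complex.Gamma (α + 1) * Complex.Gamma (α + 2) * gammaProd (α + 2 + 1) n := by
    rw [show α + n + 2 = α + 1 + ((n + 1 : ℕ) : ℂ) by push_cast; ring, ← gammaProd_succ,
      gammaProd_succ', gammaProd_succ', show α + 1 + 1 = α + 2 by ring, mul_assoc]
  rw [jacobiHankel, jacobiHankel, gammaProd_succ 1, gammaProd_succ (β + 1),
    show α + β + ((n + 1 : ℕ) : ℂ) + 1 = α + β + n + 2 by push_cast; ring,
    show α + 2 + β + n + 1 = α + β + n + 2 + 1 by ring, gammaProd_succ' (α + β + n + 2),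
    add_comm 1 (n : ℂ), Complex.Gamma_nat_eq_factorial]
  field_simp
  linear_combination -(gammaProd 1 n * gammaProd (β + 1) n) * hraise

/-! ### Exponential generating functions -/

/-- The exponential generating function `∑ a_k t^k / k!`; both analytic factors of a moment are of
this form. -/
def egf (a : ℕ → ℂ) (t : ℂ) : ℂ := ∑' k : ℕ, a k * t ^ k / (k.factorial : ℂ)

section egf

variable {a : ℕ → ℂ} {C r : ℝ}

lemma egf_zero (a : ℕ → ℂ) : egf a 0 = a 0 := by
  rw [egf, tsum_eq_single 0 fun k hk => by simp [hk]]
  simp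

lemma summable_egf (ha : ∀ k, ‖a k‖ ≤ C * r ^ k) (t : ℂ) :
    Summable fun k : ℕ => a k * t ^ k / (k.factorial : ℂ) := by
  refine Summable.of_norm_bounded ((Real.summable_pow_div_factorial (r * ‖t‖)).mul_left C)
    fun k => ?_
  rw [norm_div, norm_mul, norm_pow, Complex.norm_natCast, mul_pow, ← mul_div_assoc, ← mul_assoc]
  have := ha k
  gcongr

lemma summable_pow_mul_deriv_pow_div_factorial (r R : ℝ) :
    Summable fun k : ℕ => r ^ k * (k * R ^ (k - 1)) / k.factorial := by
  refine (summable_nat_add_iff 1).1 ?_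
  refine ((Real.summable_pow_div_factorial (r * R)).mul_left r).congr fun k => ?_
  rw [Nat.factorial_succ, Nat.add_sub_cancel]
  push_cast
  field_simp
  ring

lemma hasDerivAt_egf (ha : ∀ k, ‖a k‖ ≤ C * r ^ k) (t : ℂ) :
    HasDerivAt (egf a) (egf (fun k => a (k + 1)) t) t := by
  set R := ‖t‖ + 1 with hR
  have hu := (summable_pow_mul_deriv_pow_div_factorial r R).mul_left C
  have hbd : ∀ (k : ℕ) (y : ℂ), y ∈ Metric.ball (0 : ℂ) R →
      ‖a k * (k * y ^ (k - 1)) / (k.factorial : ℂ)‖ ≤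
        C * (r ^ k * (k * R ^ (k - 1)) / k.factorial) := by
    intro k y hy
    have hyR : ‖y‖ ≤ R := by simpa using (Metric.mem_ball.1 hy).le
    rw [norm_div, norm_mul, norm_mul, norm_pow, Complex.norm_natCast, Complex.norm_natCast,
      ← mul_div_assoc, ← mul_assoc C]
    have hak := ha k
    have := (norm_nonneg _).trans hak
    gcongr
  have ht : t ∈ Metric.ball (0 : ℂ) R := by simp [hR]
  have hderiv := hasDerivAt_tsum_of_isPreconnected hu Metric.isOpen_ball
    (convex_ball (0 : ℂ) R).isPreconnected
    (fun k y _ => ((hasDerivAt_pow k y).const_mul (a k)).div_const (k.factorial : ℂ)) hbd ht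
    (summable_egf ha t) ht
  have hs : Summable fun k : ℕ => a k * (k * t ^ (k - 1)) / (k.factorial : ℂ) :=
    Summable.of_norm_bounded hu fun k => hbd k t ht
  refine (show HasDerivAt (egf a) _ t from hderiv).congr_deriv ?_
  rw [hs.tsum_eq_zero_add, egf]
  simp only [Nat.cast_zero, zero_mul, mul_zero, zero_div, zero_add, Nat.add_sub_cancel]
  refine tsum_congr fun k => ?_
  have := Nat.cast_add_one_ne_zero (R := ℂ) k
  rw [Nat.factorial_succ]
  push_cast
  field_simp

lemma differentiable_egf (ha : ∀ k, ‖a k‖ ≤ C * r ^ k) : Differentiable ℂ (egf a) :=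
  fun t => (hasDerivAt_egf ha t).differentiableAt

end egf

/-! ### The binomial series of `(1 - x)^β` -/

/-- The coefficient of `x^k` in the expansion of `(1 - x)^β`. -/
def binomC (β : ℝ) (k : ℕ) : ℝ := (-1) ^ k * Ring.choose β k

lemma binomC_zero (β : ℝ) : binomC β 0 = 1 := by simp [binomC]

lemma binomC_succ (β : ℝ) (k : ℕ) : ((k : ℝ) + 1) * binomC β (k + 1) = (k - β) * binomC β k := by
  rw [binomC, binomC, Ring.choose_eq_smul, Ring.choose_eq_smul, descPochhammer_succ_right,
    Polynomial.smeval_mul, Nat.factorial_succ]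
  simp only [Polynomial.smeval_sub, Polynomial.smeval_X, Polynomial.smeval_natCast, pow_one,
    pow_zero, smul_eq_mul, nsmul_eq_mul]
  push_cast
  field_simp
  ring

lemma hasSum_binomC (β : ℝ) {x : ℝ} (hx : |x| < 1) :
    HasSum (fun k => binomC β k * x ^ k) ((1 - x) ^ β) := by
  have h := (Real.one_add_rpow_hasFPowerSeriesOnBall_zero (a := β)).hasSum (y := -x) (by
    rw [← ENNReal.ofReal_one, Metric.eball_ofReal]
    simpa using hx)
  rw [zero_add, ← sub_eq_add_neg] at h
  refine h.congr_fun fun k => ?_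
  rw [binomialSeries_apply]
  simp [binomC, neg_pow x]
  ring

/-- Past `k = β` the identity `(β + 1) |c_k| / (k + 1) = |c_k| - |c_{k+1}|` makes the series
telescope. -/
lemma summable_abs_binomC_div_add_one {β : ℝ} (hβ : -1 < β) :
    Summable fun k : ℕ => |binomC β k| / (k + 1) := by
  obtain ⟨N, hN⟩ := exists_nat_gt β
  refine (summable_nat_add_iff N).1 ?_
  have htelescope : ∀ k : ℕ, (β + 1) * (|binomC β (k + N)| / ((k + N : ℕ) + 1)) =
      |binomC β (k + N)| - |binomC β (k + 1 + N)| := by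
    intro k
    have hnonneg : (0 : ℝ) ≤ (k + N : ℕ) - β := by
      push_cast
      linarith [(Nat.cast_nonneg k : (0 : ℝ) ≤ k)]
    have h := congrArg abs (binomC_succ β (k + N))
    rw [abs_mul, abs_mul, abs_of_nonneg hnonneg, abs_of_nonneg (by positivity)] at h
    rw [show k + 1 + N = k + N + 1 by ring]
    field_simp
    linear_combination h
  refine summable_of_sum_range_le (c := |binomC β N| / (β + 1)) (fun _ => by positivity) fun n => ?_
  rw [le_div_iff₀ (by linarith), mul_comm, Finset.mul_sum]
  simp_rw [htelescope]
  rw [Finset.sum_range_sub' (fun k : ℕ => |binomC β (k + N)|), zero_add]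
  linarith [abs_nonneg (binomC β (n + N))]

lemma natCast_add_one_le_two_pow (k : ℕ) : (k : ℝ) + 1 ≤ 2 ^ k :=
  mod_cast Nat.succ_le_of_lt k.lt_two_pow_self

lemma exists_abs_binomC_le {β : ℝ} (hβ : -1 < β) :
    ∃ C, 0 ≤ C ∧ ∀ k : ℕ, |binomC β k| ≤ C * 2 ^ k := by
  have hC : 0 ≤ ∑' k : ℕ, |binomC β k| / (k + 1) := tsum_nonneg fun _ => by positivity
  refine ⟨_, hC, fun k => ?_⟩
  have h := (summable_abs_binomC_div_add_one hβ).le_tsum k fun _ _ => by positivity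
  rw [div_le_iff₀ (by positivity)] at h
  exact h.trans (mul_le_mul_of_nonneg_left (natCast_add_one_le_two_pow k) hC)

lemma exists_pos_le_abs_add_int {p : ℝ} (hp : ∀ m : ℤ, p ≠ m) :
    ∃ δ > 0, ∀ m : ℤ, δ ≤ |p + m| := by
  refine ⟨|p - round p|, abs_pos.2 (sub_ne_zero.2 (hp _)), fun m => ?_⟩
  simpa using round_le p (-m)

lemma natCast_add_one_le_mul_abs_add {a δ : ℝ} (hδ : 0 < δ) {k : ℕ} (h : δ ≤ |a + k|) :
    (k : ℝ) + 1 ≤ (1 + (1 + |a|) / δ) * |a + k| := by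
  have hk : (k : ℝ) ≤ |a + k| + |a| := by
    simpa using abs_sub (a + k) a
  have h1 : 1 + |a| ≤ (1 + |a|) / δ * |a + k| := by
    rw [div_mul_eq_mul_div, le_div_iff₀ hδ]
    gcongr
  linarith

lemma abs_binomC_div_le (β : ℝ) {a δ : ℝ} (hδ : 0 < δ) {k : ℕ} (h : δ ≤ |a + k|) :
    |binomC β k / (a + k)| ≤ (1 + (1 + |a|) / δ) * (|binomC β k| / (k + 1)) := by
  have hpos : 0 < |a + k| := hδ.trans_le h
  rw [abs_div, ← mul_div_assoc, div_le_div_iff₀ hpos (by positivity), mul_comm, mul_right_comm]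
  exact mul_le_mul_of_nonneg_right (natCast_add_one_le_mul_abs_add hδ h) (abs_nonneg _)

/-- The series `∑ c_k / (a + k)` obtained by integrating `x^(a-1) (1-x)^β` term by term. It
continues the Beta function `B(a, β+1)` to the non-integral `a`. -/
def betaSeries (β a : ℝ) : ℝ := ∑' k : ℕ, binomC β k / (a + k)

lemma summable_betaSeries {β a δ : ℝ} (hβ : -1 < β) (hδ : 0 < δ) (ha : ∀ k : ℕ, δ ≤ |a + k|) :
    Summable fun k : ℕ => binomC β k / (a + k) :=
  Summable.of_norm_bounded ((summable_abs_binomC_div_add_one hβ).mul_left _)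
    fun k => abs_binomC_div_le β hδ (ha k)

lemma exists_abs_binomC_div_sub_le (β : ℝ) {p : ℝ} (hp : ∀ m : ℤ, p ≠ m) :
    ∃ M, 0 ≤ M ∧ ∀ j k : ℕ,
      |binomC β k / (p - j + k)| ≤ M * 2 ^ j * (|binomC β k| / (k + 1)) := by
  obtain ⟨δ, hδ, h⟩ := exists_pos_le_abs_add_int hp
  refine ⟨1 + (1 + |p|) / δ, by positivity, fun j k => ?_⟩
  have hjk : δ ≤ |p - j + k| := by
    have := h (k - j)
    push_cast at this
    rwa [sub_add_eq_add_sub, ← add_sub_assoc] at *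
  refine (abs_binomC_div_le β hδ hjk).trans ?_
  have hj : 1 + |p - j| ≤ (1 + |p|) * (j + 1) := by
    have := abs_sub p (j : ℝ)
    rw [Nat.abs_cast] at this
    nlinarith [abs_nonneg p, (Nat.cast_nonneg j : (0 : ℝ) ≤ j)]
  gcongr
  calc 1 + (1 + |p - j|) / δ ≤ (j + 1) + (1 + |p|) * (j + 1) / δ := by
        gcongr
        exact le_add_of_nonneg_left j.cast_nonneg
    _ = (1 + (1 + |p|) / δ) * (j + 1) := by ring
    _ ≤ (1 + (1 + |p|) / δ) * 2 ^ j := by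
        gcongr
        exact natCast_add_one_le_two_pow j

lemma exists_abs_betaSeries_sub_le {β p : ℝ} (hβ : -1 < β) (hp : ∀ m : ℤ, p ≠ m) :
    ∃ C, ∀ j : ℕ, |betaSeries β (p - j)| ≤ C * 2 ^ j := by
  obtain ⟨M, -, h⟩ := exists_abs_binomC_div_sub_le β hp
  have hs := summable_abs_binomC_div_add_one hβ
  refine ⟨M * ∑' k : ℕ, |binomC β k| / (k + 1), fun j => ?_⟩
  rw [mul_right_comm]
  exact tsum_of_norm_bounded (f := fun k : ℕ => binomC β k / (p - j + k))
    (hs.hasSum.mul_left _) (h j)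

lemma mul_sum_binomC_div_sub {β a : ℝ} (ha : ∀ k : ℕ, a + k ≠ 0) (n : ℕ) :
    a * ∑ k ∈ Finset.range (n + 1), binomC β k / (a + k) -
      (a + β + 1) * ∑ k ∈ Finset.range n, binomC β k / (a + 1 + k) = binomC β n := by
  induction n with
  | zero =>
    have : a ≠ 0 := by simpa using ha 0
    simp [binomC_zero, this]
  | succ n ih =>
    have hne : a + 1 + (n : ℝ) ≠ 0 := by simpa [add_assoc, add_comm (1 : ℝ)] using ha (n + 1)
    rw [Finset.sum_range_succ, Finset.sum_range_succ (fun k : ℕ => binomC β k / (a + 1 + k)),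
      mul_add, mul_add, add_sub_add_comm, ih, Nat.cast_succ,
      show a + ((n : ℝ) + 1) = a + 1 + n by ring]
    field_simp
    linear_combination (-1 : ℝ) * binomC_succ β n

/-! ### The incomplete Gamma integral -/

open MeasureTheory Set

/-- The upper incomplete Gamma integral `∫_1^∞ y^(q-1) e^{-ty} dy`, that is `t^(-q) Γ(q, t)`. -/
def upperGammaInt (q t : ℝ) : ℝ := ∫ y in Ioi (1 : ℝ), y ^ (q - 1) * Real.exp (-(t * y))

lemma integrableOn_rpow_mul_exp {s t : ℝ} (hs : -1 < s) (ht : 0 < t) :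
    IntegrableOn (fun y : ℝ => y ^ s * Real.exp (-(t * y))) (Ioi 0) := by
  simpa [Real.rpow_one] using integrableOn_rpow_mul_exp_neg_mul_rpow hs one_pos ht

lemma integrableOn_Ioi_one_rpow_mul_exp (s : ℝ) {t : ℝ} (ht : 0 < t) :
    IntegrableOn (fun y : ℝ => y ^ s * Real.exp (-(t * y))) (Ioi 1) := by
  have h := (integrableOn_rpow_mul_exp (s := max s 0)
    (neg_one_lt_zero.trans_le (le_max_right _ _)) ht).mono_set (Ioi_subset_Ioi zero_le_one)
  refine h.mono' (by fun_prop : Measurable _).aestronglyMeasurable ?_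
  refine ae_restrict_of_forall_mem measurableSet_Ioi fun y (hy : 1 < y) => ?_
  have : 0 < y := one_pos.trans hy
  rw [Real.norm_eq_abs, abs_of_nonneg (by positivity)]
  gcongr
  exacts [hy.le, le_max_left _ _]

lemma mul_upperGammaInt_add_one (q : ℝ) {t : ℝ} (ht : 0 < t) :
    t * upperGammaInt (q + 1) t = Real.exp (-t) + q * upperGammaInt q t := by
  have hderiv : ∀ y ∈ Ici (1 : ℝ), HasDerivAt (fun y : ℝ => y ^ q * Real.exp (-(t * y)))
      (q * (y ^ (q - 1) * Real.exp (-(t * y))) - t * (y ^ (q + 1 - 1) * Real.exp (-(t * y))))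
      y := by
    intro y hy
    have hexp : HasDerivAt (fun y : ℝ => -(t * y)) (-t) y := by
      simpa using ((hasDerivAt_id y).const_mul t).fun_neg
    refine ((Real.hasDerivAt_rpow_const (p := q)
      (Or.inl (one_pos.trans_le hy).ne')).mul hexp.exp).congr_deriv ?_
    rw [add_sub_cancel_right]
    ring
  have hint := (integrableOn_Ioi_one_rpow_mul_exp (q - 1) ht).const_mul q
  have hint' := (integrableOn_Ioi_one_rpow_mul_exp (q + 1 - 1) ht).const_mul t
  have hlim : Tendsto (fun y : ℝ => y ^ q * Real.exp (-(t * y))) atTop (𝓝 0) := by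
    simpa using tendsto_rpow_mul_exp_neg_mul_atTop_nhds_zero q t ht
  have hFTC := integral_Ioi_of_hasDerivAt_of_tendsto' hderiv (hint.sub hint') hlim
  rw [integral_sub hint hint', integral_const_mul, integral_const_mul, mul_one, Real.one_rpow,
    one_mul, zero_sub] at hFTC
  rw [upperGammaInt, upperGammaInt]
  linarith

lemma integral_Ioc_rpow_mul_exp {q t : ℝ} (hq : 0 < q) (ht : 0 < t) :
    ∫ y in Ioc (0 : ℝ) 1, y ^ (q - 1) * Real.exp (-(t * y)) =
      Real.Gamma q * t ^ (-q) - upperGammaInt q t := by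
  have hint := integrableOn_rpow_mul_exp (s := q - 1) (by linarith) ht
  have hGamma := Real.integral_rpow_mul_exp_neg_mul_Ioi hq ht
  rw [← Ioc_union_Ioi_eq_Ioi zero_le_one, setIntegral_union (Ioc_disjoint_Ioi le_rfl)
    measurableSet_Ioi (hint.mono_set Ioc_subset_Ioi_self)
    (hint.mono_set (Ioi_subset_Ioi zero_le_one))] at hGamma
  rw [upperGammaInt, eq_sub_iff_add_eq, hGamma, one_div, Real.inv_rpow ht.le, Real.rpow_neg ht.le,
    mul_comm]

lemma integrableOn_Ioo_rpow {p : ℝ} (hp : 0 < p) :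
    IntegrableOn (fun x : ℝ => x ^ (p - 1)) (Ioo 0 1) :=
  (intervalIntegral.integrableOn_Ioo_rpow_iff one_pos).2 (by linarith)

lemma integral_Ioo_rpow {p : ℝ} (hp : 0 < p) : ∫ x in Ioo (0 : ℝ) 1, x ^ (p - 1) = 1 / p := by
  rw [← integral_Ioc_eq_integral_Ioo, ← intervalIntegral.integral_of_le zero_le_one,
    integral_rpow (Or.inl (by linarith)), sub_add_cancel, Real.one_rpow, Real.zero_rpow hp.ne',
    sub_zero]

lemma hasSum_integral_rpow_mul_exp {q : ℝ} (hq : 0 < q) (t : ℝ) :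
    HasSum (fun j : ℕ => (-t) ^ j / (j.factorial * (q + j)))
      (∫ y in Ioo (0 : ℝ) 1, y ^ (q - 1) * Real.exp (-(t * y))) := by
  have hqj : ∀ j : ℕ, 0 < q + j := fun j => by positivity
  have hterm : ∀ j : ℕ, ∫ y in Ioo (0 : ℝ) 1, ‖(-t) ^ j / (j.factorial : ℝ) * y ^ (q + j - 1)‖ =
      |t| ^ j / j.factorial * (1 / (q + j)) := fun j => by
    rw [← integral_Ioo_rpow (hqj j), ← integral_const_mul]
    refine setIntegral_congr_fun measurableSet_Ioo fun y hy => ?_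
    simp only [norm_mul, norm_div, norm_pow, norm_neg, Real.norm_eq_abs, Nat.abs_cast,
      abs_of_nonneg (Real.rpow_nonneg hy.1.le _)]
  have hsummable : Summable fun j : ℕ => |t| ^ j / (j.factorial : ℝ) * (1 / (q + j)) := by
    refine Summable.of_nonneg_of_le (fun j => by have := hqj j; positivity) (fun j => ?_)
      ((Real.summable_pow_div_factorial |t|).mul_right (1 / q))
    gcongr
    linarith [(Nat.cast_nonneg j : (0 : ℝ) ≤ j)]
  have hsum := hasSum_integral_of_summable_integral_norm (μ := volume.restrict (Ioo (0 : ℝ) 1))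
    (F := fun (j : ℕ) (y : ℝ) => (-t) ^ j / j.factorial * y ^ (q + j - 1))
    (fun j => (integrableOn_Ioo_rpow (hqj j)).const_mul _) (by simpa only [hterm] using hsummable)
  have hexp : ∫ y in Ioo (0 : ℝ) 1, y ^ (q - 1) * Real.exp (-(t * y)) =
      ∫ y in Ioo (0 : ℝ) 1, ∑' j : ℕ, (-t) ^ j / (j.factorial : ℝ) * y ^ (q + j - 1) := by
    refine setIntegral_congr_fun measurableSet_Ioo fun y hy => ?_
    rw [Real.exp_eq_exp_ℝ, NormedSpace.exp_eq_tsum_div, ← tsum_mul_left]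
    refine tsum_congr fun j => ?_
    rw [add_sub_right_comm, Real.rpow_add hy.1, Real.rpow_natCast, ← neg_mul, mul_pow]
    ring
  rw [hexp]
  refine hsum.congr_fun fun j => ?_
  rw [integral_const_mul, integral_Ioo_rpow (hqj j)]
  field_simp

/-- The incomplete Gamma recurrence propagates the expansion from `q + 1` to `q`. -/
lemma hasSum_upperGammaInt_of_add_one {q t : ℝ} (hq : ∀ j : ℕ, q + j ≠ 0) (ht : 0 < t)
    (h : HasSum (fun j : ℕ => (-t) ^ j / (j.factorial * (q + 1 + j)))
      (Real.Gamma (q + 1) * t ^ (-(q + 1)) - upperGammaInt (q + 1) t)) :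
    HasSum (fun j : ℕ => (-t) ^ j / (j.factorial * (q + j)))
      (Real.Gamma q * t ^ (-q) - upperGammaInt q t) := by
  have hq0 : q ≠ 0 := by simpa using hq 0
  have hexp : HasSum (fun j : ℕ => (-t) ^ j / (j.factorial : ℝ)) (Real.exp (-t)) := by
    rw [Real.exp_eq_exp_ℝ]
    exact NormedSpace.expSeries_div_hasSum_exp (-t)
  have hshift : HasSum (fun j : ℕ => (j : ℝ) * ((-t) ^ j / (j.factorial * (q + j))))
      (-t * (Real.Gamma (q + 1) * t ^ (-(q + 1)) - upperGammaInt (q + 1) t)) := by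
    rw [← hasSum_nat_add_iff' 1]
    simp only [Finset.range_one, Finset.sum_singleton, Nat.cast_zero, zero_mul, sub_zero]
    refine (h.mul_left (-t)).congr_fun fun j => ?_
    rw [Nat.factorial_succ, pow_succ]
    push_cast
    rw [show q + ((j : ℝ) + 1) = q + 1 + j by ring]
    field_simp
  have hvalue : Real.Gamma q * t ^ (-q) - upperGammaInt q t = q⁻¹ * (Real.exp (-t) -
      -t * (Real.Gamma (q + 1) * t ^ (-(q + 1)) - upperGammaInt (q + 1) t)) := by
    rw [Real.Gamma_add_one hq0, show -(q + 1) = -q - 1 by ring, Real.rpow_sub_one ht.ne']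
    field_simp
    linarith [mul_upperGammaInt_add_one q ht]
  rw [hvalue]
  refine ((hexp.sub hshift).mul_left q⁻¹).congr_fun fun j => ?_
  have := hq j
  field_simp
  ring

lemma hasSum_upperGammaInt {q t : ℝ} (hq : ∀ j : ℕ, q + j ≠ 0) (ht : 0 < t) :
    HasSum (fun j : ℕ => (-t) ^ j / (j.factorial * (q + j)))
      (Real.Gamma q * t ^ (-q) - upperGammaInt q t) := by
  obtain ⟨n, hn⟩ := exists_nat_gt (-q)
  replace hn : 0 < q + n := by linarith
  induction n generalizing q with
  | zero =>
    have hq0 : 0 < q := by simpa using hn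
    rw [← integral_Ioc_rpow_mul_exp hq0 ht, integral_Ioc_eq_integral_Ioo]
    exact hasSum_integral_rpow_mul_exp hq0 t
  | succ n ih =>
    refine hasSum_upperGammaInt_of_add_one hq ht (ih (fun j => ?_) ?_)
    · simpa [add_assoc, add_comm (1 : ℝ)] using hq (j + 1)
    · push_cast at hn
      linarith

/-! ### The moments as functions of `t` -/

/-- The integral `∫_0^1 x^(p-1) (1-x)^β e^{-t/x} dx`. The moment `μ_m(t)` is its value at
`p = α + 1 + m`. -/
def pjInt (β p : ℝ) (t : ℂ) : ℂ :=
  ∫ x in Ioo (0 : ℝ) 1, ((x ^ (p - 1) * (1 - x) ^ β : ℝ) : ℂ) * Complex.exp (-t / (x : ℂ))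

lemma pjMoment_eq_pjInt (m : ℕ) (t : ℂ) (α β : ℝ) :
    pjMoment m t α β = pjInt β (α + 1 + m) t := by
  rw [pjMoment, intervalIntegral.integral_of_le zero_le_one, integral_Ioc_eq_integral_Ioo, pjInt]
  refine setIntegral_congr_fun measurableSet_Ioo fun x hx => ?_
  simp only [pjWeight]
  rw [show α + 1 + (m : ℝ) - 1 = α + m by ring, Real.rpow_add hx.1, Real.rpow_natCast]
  push_cast
  ring

lemma norm_exp_neg_div {t : ℂ} {x : ℝ} : ‖Complex.exp (-t / (x : ℂ))‖ = Real.exp (-t.re / x) := by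
  rw [Complex.norm_exp, Complex.div_ofReal_re, Complex.neg_re]

lemma norm_ofReal_mul_exp_neg_div_le {t : ℂ} (ht : 0 ≤ t.re) {w x : ℝ} (hw : 0 ≤ w) (hx : 0 < x) :
    ‖(w : ℂ) * Complex.exp (-t / (x : ℂ))‖ ≤ w := by
  rw [norm_mul, Complex.norm_of_nonneg hw, norm_exp_neg_div]
  exact mul_le_of_le_one_right hw
    (Real.exp_le_one_iff.2 (div_nonpos_of_nonpos_of_nonneg (by linarith) hx.le))

lemma integrableOn_rpow_mul_exp_neg_div {p : ℝ} (hp : 0 < p) {t : ℂ} (ht : 0 ≤ t.re) :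
    IntegrableOn (fun x : ℝ => ((x ^ (p - 1) : ℝ) : ℂ) * Complex.exp (-t / (x : ℂ))) (Ioo 0 1) :=
  (integrableOn_Ioo_rpow hp).mono' (by fun_prop : Measurable _).aestronglyMeasurable
    (ae_restrict_of_forall_mem measurableSet_Ioo fun _ hx =>
      norm_ofReal_mul_exp_neg_div_le ht (Real.rpow_nonneg hx.1.le _) hx.1)

lemma hasSum_pjInt {β p : ℝ} (hβ : -1 < β) (hp : 0 < p) {t : ℂ} (ht : 0 ≤ t.re) :
    HasSum (fun k : ℕ => (binomC β k : ℂ) * ∫ x in Ioo (0 : ℝ) 1,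
      ((x ^ (p + k - 1) : ℝ) : ℂ) * Complex.exp (-t / (x : ℂ))) (pjInt β p t) := by
  have hpk : ∀ k : ℕ, 0 < p + k := fun k => by positivity
  have hbound : ∀ k : ℕ, ∫ x in Ioo (0 : ℝ) 1, ‖(binomC β k : ℂ) *
      (((x ^ (p + k - 1) : ℝ) : ℂ) * Complex.exp (-t / (x : ℂ)))‖ ≤ |binomC β k / (p + k)| := by
    intro k
    rw [abs_div, abs_of_pos (hpk k), ← mul_one_div, ← integral_Ioo_rpow (hpk k),
      ← integral_const_mul]
    refine setIntegral_mono_on ((integrableOn_rpow_mul_exp_neg_div (hpk k) ht).const_mul _).norm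
      ((integrableOn_Ioo_rpow (hpk k)).const_mul _) measurableSet_Ioo fun x hx => ?_
    rw [norm_mul, Complex.norm_real, Real.norm_eq_abs]
    exact mul_le_mul_of_nonneg_left
      (norm_ofReal_mul_exp_neg_div_le ht (Real.rpow_nonneg hx.1.le _) hx.1) (abs_nonneg _)
  have hsummable : Summable fun k : ℕ => |binomC β k / (p + k)| :=
    (summable_betaSeries hβ hp fun k => (le_add_of_nonneg_right k.cast_nonneg).trans
      (le_abs_self _)).abs
  have hsum := hasSum_integral_of_summable_integral_norm (μ := volume.restrict (Ioo (0 : ℝ) 1))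
    (F := fun (k : ℕ) (x : ℝ) => (binomC β k : ℂ) *
      (((x ^ (p + k - 1) : ℝ) : ℂ) * Complex.exp (-t / (x : ℂ))))
    (fun k => (integrableOn_rpow_mul_exp_neg_div (hpk k) ht).const_mul _)
    (Summable.of_nonneg_of_le (fun k => integral_nonneg fun _ => norm_nonneg _) hbound hsummable)
  have hexpand : pjInt β p t = ∫ x in Ioo (0 : ℝ) 1, ∑' k : ℕ, (binomC β k : ℂ) *
      (((x ^ (p + k - 1) : ℝ) : ℂ) * Complex.exp (-t / (x : ℂ))) := by
    refine setIntegral_congr_fun measurableSet_Ioo fun x hx => ?_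
    have hbinom := hasSum_binomC β (x := x) (by rw [abs_of_pos hx.1]; exact hx.2)
    rw [Complex.ofReal_mul, ← (((Complex.hasSum_ofReal.2 hbinom).mul_left
      ((x ^ (p - 1) : ℝ) : ℂ)).mul_right (Complex.exp (-t / (x : ℂ)))).tsum_eq]
    refine tsum_congr fun k => ?_
    rw [add_sub_right_comm, Real.rpow_add hx.1, Real.rpow_natCast]
    push_cast
    ring
  rw [hexpand]
  exact hsum.congr_fun fun k => (integral_const_mul _ _).symm

lemma ofReal_rpow_mul_one_sub_rpow (β p : ℝ) {x : ℝ} (hx : x ∈ Ioo (0 : ℝ) 1) :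
    ((x ^ (p - 1) * (1 - x) ^ β : ℝ) : ℂ) =
      (x : ℂ) ^ ((p : ℂ) - 1) * (1 - (x : ℂ)) ^ ((β : ℂ) + 1 - 1) := by
  rw [Complex.ofReal_mul, Complex.ofReal_cpow hx.1.le, Complex.ofReal_cpow (sub_nonneg.2 hx.2.le)]
  push_cast
  rw [add_sub_cancel_right]

lemma integrableOn_rpow_mul_one_sub_rpow {β p : ℝ} (hβ : -1 < β) (hp : 0 < p) :
    IntegrableOn (fun x : ℝ => x ^ (p - 1) * (1 - x) ^ β) (Ioo 0 1) := by
  have h := Complex.betaIntegral_convergent (u := (p : ℂ)) (v := (β : ℂ) + 1) (by simpa using hp)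
    (by simpa using (by linarith : 0 < β + 1))
  rw [intervalIntegrable_iff_integrableOn_Ioo_of_le zero_le_one] at h
  have h' := h.congr_fun (fun x hx => (ofReal_rpow_mul_one_sub_rpow β p hx).symm) measurableSet_Ioo
  exact h'.re

lemma pjInt_zero {β p : ℝ} (hβ : -1 < β) (hp : 0 < p) : pjInt β p 0 = gammaBeta p (β + 1) := by
  rw [gammaBeta, ← Complex.betaIntegral_eq_Gamma_mul_div _ _ (by simpa using hp)
    (by simpa using (by linarith : 0 < β + 1)), Complex.betaIntegral,
    intervalIntegral.integral_of_le zero_le_one, integral_Ioc_eq_integral_Ioo, pjInt]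
  refine setIntegral_congr_fun measurableSet_Ioo fun x hx => ?_
  simp only [neg_zero, zero_div, Complex.exp_zero, mul_one]
  exact ofReal_rpow_mul_one_sub_rpow β p hx

lemma betaSeries_of_pos {β a : ℝ} (hβ : -1 < β) (ha : 0 < a) :
    (betaSeries β a : ℂ) = gammaBeta a (β + 1) := by
  rw [betaSeries, Complex.ofReal_tsum, ← pjInt_zero hβ ha,
    ← (hasSum_pjInt hβ ha (t := 0) le_rfl).tsum_eq]
  refine tsum_congr fun k => ?_
  simp only [neg_zero, zero_div, Complex.exp_zero, mul_one]
  rw [integral_complex_ofReal, integral_Ioo_rpow (by positivity : 0 < a + (k : ℝ)),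
    ← Complex.ofReal_mul, mul_one_div]

lemma mul_gammaBeta {a : ℂ} (ha : a ≠ 0) (c : ℂ) :
    a * gammaBeta a c = (a + c) * gammaBeta (a + 1) c := by
  rw [gammaBeta, gammaBeta, Complex.Gamma_add_one a ha, add_right_comm, div_eq_mul_inv,
    Complex.one_div_Gamma_eq_self_mul_one_div_Gamma_add_one]
  ring

lemma tendsto_binomC_of_le_abs_add {β a δ : ℝ} (hβ : -1 < β) (hδ : 0 < δ)
    (ha : ∀ k : ℕ, δ ≤ |a + k|) :
    Tendsto (binomC β) atTop (𝓝 (a * betaSeries β a - (a + β + 1) * betaSeries β (a + 1))) := by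
  have hs := summable_betaSeries hβ hδ ha
  have hs' := summable_betaSeries (a := a + 1) hβ hδ fun k => by
    simpa [add_assoc, add_comm (1 : ℝ)] using ha (k + 1)
  have hlim := (((tendsto_add_atTop_iff_nat 1).2 hs.hasSum.tendsto_sum_nat).const_mul a).sub
    (hs'.hasSum.tendsto_sum_nat.const_mul (a + β + 1))
  simp_rw [mul_sum_binomC_div_sub fun k => abs_pos.1 (hδ.trans_le (ha k))] at hlim
  exact hlim

lemma tendsto_binomC {β : ℝ} (hβ : -1 < β) : Tendsto (binomC β) atTop (𝓝 0) := by
  have hlim := tendsto_binomC_of_le_abs_add (a := 1) hβ one_pos fun k => by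
    rw [abs_of_nonneg (by positivity)]
    exact le_add_of_nonneg_right k.cast_nonneg
  have hzero : 1 * betaSeries β 1 - (1 + β + 1) * betaSeries β (1 + 1) = 0 := by
    apply Complex.ofReal_injective
    have h := mul_gammaBeta one_ne_zero (β + 1 : ℂ)
    have h1 := betaSeries_of_pos (a := 1) hβ one_pos
    have h2 := betaSeries_of_pos (a := 1 + 1) hβ (by norm_num)
    push_cast at h1 h2 ⊢
    rw [h1, h2]
    linear_combination h
  rwa [hzero] at hlim

lemma betaSeries_recurrence {β a : ℝ} (hβ : -1 < β) (ha : ∀ m : ℤ, a ≠ m) :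
    a * betaSeries β a = (a + β + 1) * betaSeries β (a + 1) := by
  obtain ⟨δ, hδ, h⟩ := exists_pos_le_abs_add_int ha
  have hlim := tendsto_binomC_of_le_abs_add hβ hδ fun k : ℕ => mod_cast h k
  exact sub_eq_zero.1 (tendsto_nhds_unique hlim (tendsto_binomC hβ))

lemma betaSeries_eq_gammaBeta {β a : ℝ} (hβ : -1 < β) (ha : ∀ m : ℤ, a ≠ m) :
    (betaSeries β a : ℂ) = gammaBeta a (β + 1) := by
  obtain ⟨n, hn⟩ := exists_nat_gt (-a)
  replace hn : 0 < a + n := by linarith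
  induction n generalizing a with
  | zero => exact betaSeries_of_pos hβ (by simpa using hn)
  | succ n ih =>
    have ha0 : (a : ℂ) ≠ 0 := by exact_mod_cast ha 0
    have ih := ih (a := a + 1) (fun m h => ha (m - 1) (by push_cast; linarith))
      (by push_cast at hn; linarith)
    have hrec := congrArg ((↑) : ℝ → ℂ) (betaSeries_recurrence hβ ha)
    push_cast at ih hrec
    rw [← mul_right_inj' ha0, hrec, ih, mul_gammaBeta ha0]
    ring

/-- The part of `pjInt β p` that is analytic at the origin. -/
def regPart (β p : ℝ) : ℂ → ℂ := egf fun j => (((-1) ^ j * betaSeries β (p - j) : ℝ) : ℂ)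

/-- The factor of `t^p` in `pjInt β p`. -/
def singPart (β p : ℝ) : ℂ → ℂ :=
  egf fun k => ((binomC β k * (Real.Gamma (-(p + k)) * k.factorial) : ℝ) : ℂ)

lemma exists_regPart_bound {β p : ℝ} (hβ : -1 < β) (hp : ∀ m : ℤ, p ≠ m) :
    ∃ C, ∀ j : ℕ, ‖(((-1) ^ j * betaSeries β (p - j) : ℝ) : ℂ)‖ ≤ C * 2 ^ j := by
  obtain ⟨C, hC⟩ := exists_abs_betaSeries_sub_le hβ hp
  refine ⟨C, fun j => ?_⟩
  rw [Complex.norm_real, Real.norm_eq_abs, abs_mul, abs_neg_one_pow, one_mul]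
  exact hC j

lemma hasDerivAt_regPart {β p : ℝ} (hβ : -1 < β) (hp : ∀ m : ℤ, p ≠ m) (t : ℂ) :
    HasDerivAt (regPart β p) (-regPart β (p - 1) t) t := by
  obtain ⟨C, hC⟩ := exists_regPart_bound hβ hp
  refine (hasDerivAt_egf hC t).congr_deriv ?_
  rw [regPart, egf, egf, ← tsum_neg]
  refine tsum_congr fun k => ?_
  rw [show p - ((k + 1 : ℕ) : ℝ) = p - 1 - k by push_cast; ring]
  push_cast
  ring

lemma differentiable_regPart {β p : ℝ} (hβ : -1 < β) (hp : ∀ m : ℤ, p ≠ m) :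
    Differentiable ℂ (regPart β p) := fun t => (hasDerivAt_regPart hβ hp t).differentiableAt

lemma regPart_zero {β p : ℝ} (hβ : -1 < β) (hp : ∀ m : ℤ, p ≠ m) :
    regPart β p 0 = gammaBeta p (β + 1) := by
  rw [regPart, egf_zero, ← betaSeries_eq_gammaBeta hβ hp, pow_zero, one_mul, Nat.cast_zero,
    sub_zero]

lemma abs_Gamma_neg_mul_factorial_le {p : ℝ} (hp : 0 < p) (k : ℕ) :
    |Real.Gamma (-(p + k)) * k.factorial| ≤ |Real.Gamma (-p)| := by
  induction k with
  | zero => simp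
  | succ k ih =>
    have hpos : 0 < p + k + 1 := by positivity
    have hGamma : Real.Gamma (-(p + k)) = -(p + k + 1) * Real.Gamma (-(p + (k + 1 : ℕ))) := by
      have := Real.Gamma_add_one (s := -(p + (k + 1 : ℕ))) (by push_cast; linarith)
      push_cast at this ⊢
      rw [← sub_eq_zero] at this ⊢
      ring_nf at this ⊢
      exact this
    refine le_trans ?_ ih
    rw [hGamma, Nat.factorial_succ, Nat.cast_mul, ← mul_assoc, abs_mul, abs_mul, abs_mul, abs_mul,
      abs_neg, abs_of_pos hpos, Nat.abs_cast, Nat.abs_cast, mul_comm |Real.Gamma _|]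
    gcongr
    push_cast
    linarith

lemma exists_singPart_bound {β p : ℝ} (hβ : -1 < β) (hp : 0 < p) :
    ∃ C, ∀ k : ℕ,
      ‖((binomC β k * (Real.Gamma (-(p + k)) * k.factorial) : ℝ) : ℂ)‖ ≤ C * 2 ^ k := by
  obtain ⟨C, hC, h⟩ := exists_abs_binomC_le hβ
  refine ⟨C * |Real.Gamma (-p)|, fun k => ?_⟩
  rw [Complex.norm_real, Real.norm_eq_abs, abs_mul, mul_right_comm]
  exact mul_le_mul (h k) (abs_Gamma_neg_mul_factorial_le hp k) (abs_nonneg _) (by positivity)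

lemma differentiable_singPart {β p : ℝ} (hβ : -1 < β) (hp : 0 < p) :
    Differentiable ℂ (singPart β p) := by
  obtain ⟨C, hC⟩ := exists_singPart_bound hβ hp
  exact differentiable_egf hC

lemma singPart_zero (β p : ℝ) : singPart β p 0 = Complex.Gamma (-p) := by
  rw [singPart, egf_zero]
  simp [binomC_zero, ← Complex.Gamma_ofReal]

lemma integral_rpow_mul_exp_neg_div (p t : ℝ) :
    ∫ x in Ioo (0 : ℝ) 1, x ^ (p - 1) * Real.exp (-t / x) = upperGammaInt (-p) t := by
  have himage : (fun y : ℝ => y⁻¹) '' Ioi 1 = Ioo 0 1 := by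
    rw [Set.image_inv_eq_inv, inv_Ioi₀ one_pos, inv_one]
  rw [← himage, integral_image_eq_integral_abs_deriv_smul measurableSet_Ioi
    (fun y (hy : 1 < y) => (hasDerivAt_inv (one_pos.trans hy).ne').hasDerivWithinAt)
    inv_injective.injOn, upperGammaInt]
  refine setIntegral_congr_fun measurableSet_Ioi fun y (hy : 1 < y) => ?_
  have hy0 : 0 < y := one_pos.trans hy
  simp only [smul_eq_mul]
  rw [abs_neg, abs_of_nonneg (by positivity), Real.inv_rpow hy0.le, ← Real.rpow_neg hy0.le,
    ← Real.rpow_natCast, ← Real.rpow_neg hy0.le, ← mul_assoc, ← Real.rpow_add hy0, div_inv_eq_mul,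
    neg_mul]
  congr 2
  push_cast
  ring

lemma hasSum_pjInt_ofReal {β p t : ℝ} (hβ : -1 < β) (hp : 0 < p) (ht : 0 ≤ t) :
    HasSum (fun k : ℕ => ((binomC β k * upperGammaInt (-(p + k)) t : ℝ) : ℂ)) (pjInt β p t) := by
  refine (hasSum_pjInt hβ hp (t := t) ht).congr_fun fun k => ?_
  rw [← integral_rpow_mul_exp_neg_div, Complex.ofReal_mul, ← integral_complex_ofReal]
  congr 2 with x
  push_cast
  rfl

lemma hasSum_cpow_mul_singPart {β p t : ℝ} (hβ : -1 < β) (hp : 0 < p) (ht : 0 < t) :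
    HasSum (fun k : ℕ => ((binomC β k * (Real.Gamma (-(p + k)) * t ^ (p + k)) : ℝ) : ℂ))
      ((t : ℂ) ^ (p : ℂ) * singPart β p t) := by
  obtain ⟨C, hC⟩ := exists_singPart_bound hβ hp
  refine ((summable_egf hC t).hasSum.mul_left ((t : ℂ) ^ (p : ℂ))).congr_fun fun k => ?_
  have : (k.factorial : ℂ) ≠ 0 := by exact_mod_cast k.factorial_ne_zero
  rw [Real.rpow_add ht, Real.rpow_natCast]
  push_cast [Complex.ofReal_cpow ht.le]
  field_simp

lemma summable_binomC_div_mul_pow_div_factorial {β p : ℝ} (hβ : -1 < β) (hp : ∀ m : ℤ, p ≠ m)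
    (t : ℝ) :
    Summable (Function.uncurry fun k j : ℕ =>
      binomC β k / (p - j + k) * ((-t) ^ j / j.factorial)) := by
  obtain ⟨M, hM, h⟩ := exists_abs_binomC_div_sub_le β hp
  refine Summable.of_norm_bounded ((((summable_abs_binomC_div_add_one hβ).mul_left M).mul_of_nonneg
    (Real.summable_pow_div_factorial (2 * |t|)) (fun k => by positivity)
    (fun j => by positivity))) fun ⟨k, j⟩ => ?_
  simp only [Function.uncurry_apply_pair, Real.norm_eq_abs]
  rw [abs_mul, abs_div ((-t) ^ j), abs_pow, abs_neg, Nat.abs_cast, mul_pow]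
  calc _ ≤ M * 2 ^ j * (|binomC β k| / (k + 1)) * (|t| ^ j / j.factorial) := by
        gcongr
        exact h j k
    _ = _ := by ring

/-- Interchanging the binomial series with the series of the incomplete Gamma function. -/
lemma regPart_ofReal_eq_tsum {β p t : ℝ} (hβ : -1 < β) (hp : ∀ m : ℤ, p ≠ m) (ht : 0 < t) :
    regPart β p t = ∑' k : ℕ, ((binomC β k *
      (upperGammaInt (-(p + k)) t - Real.Gamma (-(p + k)) * t ^ (p + k)) : ℝ) : ℂ) := by
  have hinner : ∀ k : ℕ, ∑' j : ℕ, binomC β k / (p - j + k) * ((-t) ^ j / j.factorial) =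
      binomC β k * (upperGammaInt (-(p + k)) t - Real.Gamma (-(p + k)) * t ^ (p + k)) := by
    intro k
    have hne : ∀ j : ℕ, -(p + (k : ℝ)) + j ≠ 0 := fun j h0 =>
      hp (j - k) (by push_cast; linarith)
    have hsum := hasSum_upperGammaInt hne ht
    rw [neg_neg] at hsum
    rw [← neg_sub (Real.Gamma _ * _), mul_neg, ← neg_mul, ← (hsum.mul_left _).tsum_eq]
    refine tsum_congr fun j => ?_
    rw [show p - j + (k : ℝ) = -(-(p + k) + j) by ring]
    have := hne j
    field_simp
  simp_rw [← hinner]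
  rw [← Complex.ofReal_tsum, ← (summable_binomC_div_mul_pow_div_factorial hβ hp t).tsum_comm,
    regPart, egf, Complex.ofReal_tsum]
  refine tsum_congr fun j => ?_
  rw [tsum_mul_right, ← betaSeries, neg_pow t]
  push_cast
  ring

lemma pjInt_ofReal_eq {β p t : ℝ} (hβ : -1 < β) (hp : 0 < p) (hp' : ∀ m : ℤ, p ≠ m) (ht : 0 < t) :
    pjInt β p t = regPart β p t + (t : ℂ) ^ (p : ℂ) * singPart β p t := by
  have hdiff := (hasSum_pjInt_ofReal hβ hp ht.le).sub (hasSum_cpow_mul_singPart hβ hp ht)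
  rw [← sub_eq_iff_eq_add, ← hdiff.tsum_eq, regPart_ofReal_eq_tsum hβ hp' ht]
  refine tsum_congr fun k => ?_
  push_cast
  ring

lemma continuousOn_pjInt {β p : ℝ} (hβ : -1 < β) (hp : 0 < p) :
    ContinuousOn (pjInt β p) {t | 0 ≤ t.re} :=
  continuousOn_of_dominated
    (fun _ _ => (by fun_prop : Measurable _).aestronglyMeasurable)
    (fun _ ht => ae_restrict_of_forall_mem measurableSet_Ioo fun x hx =>
      norm_ofReal_mul_exp_neg_div_le ht
        (mul_nonneg (Real.rpow_nonneg hx.1.le _) (Real.rpow_nonneg (sub_nonneg.2 hx.2.le) _)) hx.1)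
    (integrableOn_rpow_mul_one_sub_rpow hβ hp) (ae_of_all _ fun _ => by fun_prop)

lemma norm_inv_mul_exp_neg_div_le {ε : ℝ} (hε : 0 < ε) {t : ℂ} (ht : ε ≤ t.re) {x : ℝ}
    (hx : 0 < x) : ‖(x : ℂ)⁻¹ * Complex.exp (-t / (x : ℂ))‖ ≤ ε⁻¹ := by
  rw [norm_mul, norm_inv, Complex.norm_of_nonneg hx.le, norm_exp_neg_div, neg_div, Real.exp_neg,
    ← mul_inv]
  refine inv_anti₀ hε ?_
  have hexp : ε / x ≤ Real.exp (t.re / x) :=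
    (div_le_div_of_nonneg_right ht hx.le).trans (by linarith [Real.add_one_le_exp (t.re / x)])
  calc ε = x * (ε / x) := by field_simp
    _ ≤ x * Real.exp (t.re / x) := by gcongr

lemma hasDerivAt_mul_exp_neg_div (w : ℂ) (x : ℝ) (t : ℂ) :
    HasDerivAt (fun t : ℂ => w * Complex.exp (-t / (x : ℂ)))
      (-(w * ((x : ℂ)⁻¹ * Complex.exp (-t / (x : ℂ))))) t := by
  refine (((hasDerivAt_id t).neg.div_const (x : ℂ)).cexp.const_mul w).congr_deriv ?_
  simp only [Pi.neg_apply, id]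
  field_simp

lemma isOpen_re_pos : IsOpen {t : ℂ | 0 < t.re} := isOpen_lt continuous_const Complex.continuous_re

lemma differentiableOn_pjInt {β p : ℝ} (hβ : -1 < β) (hp : 0 < p) :
    DifferentiableOn ℂ (pjInt β p) {t | 0 < t.re} := by
  intro t ht
  have hε : 0 < t.re / 2 := half_pos ht
  have hint := integrableOn_rpow_mul_one_sub_rpow hβ hp
  have hnonneg : ∀ x ∈ Ioo (0 : ℝ) 1, 0 ≤ x ^ (p - 1) * (1 - x) ^ β := fun x hx =>
    mul_nonneg (Real.rpow_nonneg hx.1.le _) (Real.rpow_nonneg (sub_nonneg.2 hx.2.le) _)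
  have hnhds : {s : ℂ | t.re / 2 < s.re} ∈ 𝓝 t :=
    (isOpen_lt continuous_const Complex.continuous_re).mem_nhds
      (show t.re / 2 < t.re from half_lt_self ht)
  have hderiv := hasDerivAt_integral_of_dominated_loc_of_deriv_le
    (μ := volume.restrict (Ioo (0 : ℝ) 1))
    (F := fun t x => ((x ^ (p - 1) * (1 - x) ^ β : ℝ) : ℂ) * Complex.exp (-t / (x : ℂ)))
    (F' := fun t x => -(((x ^ (p - 1) * (1 - x) ^ β : ℝ) : ℂ) *
      ((x : ℂ)⁻¹ * Complex.exp (-t / (x : ℂ)))))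
    (bound := fun x => x ^ (p - 1) * (1 - x) ^ β * (t.re / 2)⁻¹) hnhds
    (Eventually.of_forall fun _ => (by fun_prop : Measurable _).aestronglyMeasurable)
    (hint.mono' (by fun_prop : Measurable _).aestronglyMeasurable
      (ae_restrict_of_forall_mem measurableSet_Ioo fun x hx =>
        norm_ofReal_mul_exp_neg_div_le (le_of_lt ht) (hnonneg x hx) hx.1))
    (by fun_prop : Measurable _).aestronglyMeasurable
    (ae_restrict_of_forall_mem measurableSet_Ioo fun x hx s hs => by
      rw [norm_neg, norm_mul, Complex.norm_of_nonneg (hnonneg x hx)]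
      exact mul_le_mul_of_nonneg_left (norm_inv_mul_exp_neg_div_le hε (le_of_lt hs) hx.1)
        (hnonneg x hx))
    (hint.mul_const _)
    (ae_restrict_of_forall_mem measurableSet_Ioo fun x _ s _ =>
      hasDerivAt_mul_exp_neg_div _ x s)
  exact hderiv.2.differentiableAt.differentiableWithinAt

lemma differentiableOn_regPart_add_singPart {β p : ℝ} (hβ : -1 < β) (hp : 0 < p)
    (hp' : ∀ m : ℤ, p ≠ m) :
    DifferentiableOn ℂ (fun t => regPart β p t + t ^ (p : ℂ) * singPart β p t)
      Complex.slitPlane := fun t ht =>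
  ((differentiable_regPart hβ hp' t).add
    ((differentiableAt_id.cpow (differentiableAt_const _) ht).mul
      (differentiable_singPart hβ hp t))).differentiableWithinAt

lemma pjInt_eq_of_re_pos {β p : ℝ} (hβ : -1 < β) (hp : 0 < p) (hp' : ∀ m : ℤ, p ≠ m) {t : ℂ}
    (ht : 0 < t.re) : pjInt β p t = regPart β p t + t ^ (p : ℂ) * singPart β p t := by
  have hpjInt := (differentiableOn_pjInt hβ hp).analyticOnNhd isOpen_re_pos
  have hparts := ((differentiableOn_regPart_add_singPart hβ hp hp').mono
    (fun t (ht : 0 < t.re) => Or.inl ht)).analyticOnNhd isOpen_re_pos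
  refine hpjInt.eqOn_of_preconnected_of_frequently_eq hparts
    (convex_halfSpace_re_gt 0).isPreconnected (z₀ := 1) (by simp) ?_ ht
  have htendsto : Tendsto ((↑) : ℝ → ℂ) (𝓝[>] 1) (𝓝[≠] 1) :=
    tendsto_nhdsWithin_iff.2 ⟨Complex.continuous_ofReal.tendsto' 1 1 Complex.ofReal_one
      |>.mono_left nhdsWithin_le_nhds, by
        filter_upwards [self_mem_nhdsWithin] with s (hs : 1 < s)
        exact Complex.ofReal_ne_one.2 hs.ne'⟩
  refine htendsto.frequently (Eventually.frequently ?_)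
  filter_upwards [self_mem_nhdsWithin] with s (hs : 1 < s)
  exact pjInt_ofReal_eq hβ hp hp' (one_pos.trans hs)

lemma pjInt_eq {β p : ℝ} (hβ : -1 < β) (hp : 0 < p) (hp' : ∀ m : ℤ, p ≠ m) {t : ℂ}
    (ht : 0 ≤ t.re) (ht' : t ∈ Complex.slitPlane) :
    pjInt β p t = regPart β p t + t ^ (p : ℂ) * singPart β p t := by
  have hpath : Tendsto (fun ε : ℝ => t + ε) (𝓝[>] 0) (𝓝 t) :=
    ((by fun_prop : Continuous fun ε : ℝ => t + (ε : ℂ)).tendsto' 0 t (by simp)).mono_left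
      nhdsWithin_le_nhds
  have hre : ∀ᶠ ε : ℝ in 𝓝[>] 0, 0 < (t + ε).re := by
    filter_upwards [self_mem_nhdsWithin] with ε (hε : 0 < ε)
    rw [Complex.add_re, Complex.ofReal_re]
    linarith
  have hpjInt := (continuousOn_pjInt hβ hp t ht).tendsto.comp
    (tendsto_nhdsWithin_iff.2 ⟨hpath, hre.mono fun _ => le_of_lt⟩)
  have hparts := ((differentiableOn_regPart_add_singPart hβ hp hp').differentiableAt
    (Complex.isOpen_slitPlane.mem_nhds ht')).continuousAt.tendsto.comp hpath
  exact tendsto_nhds_unique hpjInt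
    (hparts.congr' (hre.mono fun _ hε => (pjInt_eq_of_re_pos hβ hp hp' hε).symm))

/-! ### Derivatives of determinants -/

lemma hasDerivAt_det {𝕜 ι : Type*} [NontriviallyNormedField 𝕜] [Fintype ι] [DecidableEq ι]
    {M : 𝕜 → Matrix ι ι 𝕜} {M' : Matrix ι ι 𝕜} {t : 𝕜}
    (h : ∀ i j, HasDerivAt (fun s => M s i j) (M' i j) t) :
    HasDerivAt (fun s => (M s).det) (∑ i, ((M t).updateRow i (M' i)).det) t := by
  have hrow (N : Matrix ι ι 𝕜) :
      N.det = ∑ σ : Equiv.Perm ι, ((Equiv.Perm.sign σ : ℤ) : 𝕜) * ∏ i, N i (σ i) := by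
    rw [← Matrix.det_transpose, Matrix.det_apply']
    rfl
  simp_rw [hrow]
  refine (HasDerivAt.fun_sum fun (σ : Equiv.Perm ι) _ =>
    (HasDerivAt.fun_finsetProd fun i _ => h i (σ i)).const_mul
      ((Equiv.Perm.sign σ : ℤ) : 𝕜)).congr_deriv ?_
  rw [Finset.sum_comm]
  refine Finset.sum_congr rfl fun σ _ => ?_
  rw [Finset.mul_sum]
  refine Finset.sum_congr rfl fun i _ => ?_
  rw [← Finset.mul_prod_erase _ _ (Finset.mem_univ i), Matrix.updateRow_self, smul_eq_mul,
    mul_comm (M' i (σ i))]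
  congr 2
  exact Finset.prod_congr rfl fun j hj => by
    rw [Matrix.updateRow_ne (Finset.ne_of_mem_erase hj)]

lemma differentiableAt_det {𝕜 ι : Type*} [NontriviallyNormedField 𝕜] [Fintype ι] [DecidableEq ι]
    {M : 𝕜 → Matrix ι ι 𝕜} {t : 𝕜} (h : ∀ i j, DifferentiableAt 𝕜 (fun s => M s i j) t) :
    DifferentiableAt 𝕜 (fun s => (M s).det) t :=
  (hasDerivAt_det fun i j => (h i j).hasDerivAt).differentiableAt

lemma isBigO_sub_taylor_two {f g h : ℂ → ℂ} (hf : ∀ t, HasDerivAt f (g t) t)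
    (hg : ∀ t, HasDerivAt g (h t) t) :
    (fun t => f t - (f 0 + g 0 * t + h 0 / 2 * t ^ 2)) =O[𝓝 0] fun t => t ^ 3 := by
  have hdf : Differentiable ℂ f := fun t => (hf t).differentiableAt
  have hderiv : deriv f = g := funext fun t => (hf t).deriv
  have hderiv₂ : deriv g = h := funext fun t => (hg t).deriv
  have hseries := (hdf.analyticAt 0).hasFPowerSeriesAt.isBigO_sub_partialSum_pow 3
  refine (hseries.congr_left fun t => ?_).trans (IsBigO.of_norm_left ?_)
  · simp only [FormalMultilinearSeries.partialSum, Finset.sum_range_succ, Finset.sum_range_zero,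
      zero_add, FormalMultilinearSeries.ofScalars_apply_eq, iteratedDeriv_zero,
      iteratedDeriv_succ, hderiv, hderiv₂, smul_eq_mul]
    norm_num
  · simp only [norm_norm, norm_pow]
    exact IsBigO.of_bound 1 (Eventually.of_forall fun t => by simp)

/-! ### Determinants of regular parts -/

lemma add_intCast_ne_intCast {a : ℝ} (ha : ∀ m : ℤ, a ≠ m) (j m : ℤ) : a + j ≠ m := fun h =>
  ha (m - j) (by push_cast; linarith)

lemma ofReal_add_natCast_ne_zero {a : ℝ} (ha : ∀ m : ℤ, a ≠ m) (k : ℕ) : (a : ℂ) + k ≠ 0 := by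
  have := add_intCast_ne_intCast ha k 0
  exact_mod_cast this

lemma ofReal_add_one_add_natCast_ne_zero {x : ℝ} (hx : -1 < x) (k : ℕ) : (x : ℂ) + 1 + k ≠ 0 := by
  have : 0 < x + 1 + k := add_pos_of_pos_of_nonneg (by linarith) k.cast_nonneg
  exact_mod_cast this.ne'

lemma jacobiHankel_ofReal_ne_zero (n : ℕ) {α β : ℝ} (hα : -1 < α) (hβ : -1 < β) :
    jacobiHankel (n + 1) α β ≠ 0 := by
  refine jacobiHankel_ne_zero (ofReal_add_one_add_natCast_ne_zero hα)
    (ofReal_add_one_add_natCast_ne_zero hβ) fun k => ?_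
  have : 0 < α + β + (n + 1 : ℕ) + 1 + k := by
    push_cast
    linarith [(Nat.cast_nonneg n : (0 : ℝ) ≤ n), (Nat.cast_nonneg k : (0 : ℝ) ≤ k)]
  exact_mod_cast this.ne'

lemma arith_ne_intCast {x : ℝ} (hx : ∀ m : ℤ, x ≠ m) {n : ℕ} (i : Fin n) (m : ℤ) :
    arith x n i ≠ m :=
  add_intCast_ne_intCast hx (i : ℕ) m

lemma ofReal_comp_arith (x : ℝ) (n : ℕ) : Complex.ofReal ∘ arith x n = arith (x : ℂ) n := by
  ext i
  simp [arith]

/-- The matrix of the regular parts with exponents `a_i + j`. -/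
def regMatrix {n : ℕ} (β : ℝ) (a : Fin n → ℝ) (t : ℂ) : Matrix (Fin n) (Fin n) ℂ :=
  Matrix.of fun i j => regPart β (a i + (j : ℕ)) t

/-- The determinant of the regular parts for an arbitrary sequence of row parameters. Arbitrary rows
are needed because differentiating in `t` lowers the parameter of one row by one. -/
def regDet {n : ℕ} (β : ℝ) (a : Fin n → ℝ) (t : ℂ) : ℂ := (regMatrix β a t).det

lemma regDet_eq_zero {n : ℕ} (β : ℝ) {a : Fin n → ℝ} {i k : Fin n} (hik : i ≠ k)
    (h : a i = a k) (t : ℂ) : regDet β a t = 0 :=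
  Matrix.det_zero_of_row_eq hik (by ext j; simp only [regMatrix, Matrix.of_apply, h])

lemma regDet_cons_update_arith_eq_zero (β x y : ℝ) {n : ℕ} (i : Fin n) (t : ℂ) :
    regDet β (Fin.cons x (Function.update (arith y (n + 1)) i.succ
      (arith y (n + 1) i.succ - 1))) t = 0 := by
  have hne : i.castSucc ≠ i.succ := i.castSucc_lt_succ.ne
  refine regDet_eq_zero β (i := i.castSucc.succ) (k := i.succ.succ)
    (fun h => hne (Fin.succ_injective _ h)) ?_ t
  rw [Fin.cons_succ, Fin.cons_succ, Function.update_of_ne hne, Function.update_self, arith, arith,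
    Fin.val_succ, Fin.val_castSucc]
  push_cast
  ring

lemma ascPochhammer_two_eval (z : ℂ) : (ascPochhammer ℂ 2).eval z = z * (z + 1) := by
  simp [ascPochhammer_succ_eval]

lemma cast_choose_two_add (n : ℕ) : ((2 + n).choose n : ℂ) = (n + 2) * (n + 1) / 2 := by
  rw [add_comm 2 n, Nat.choose_symm_add, Nat.cast_choose_two]
  push_cast
  ring

section

variable {β : ℝ} (hβ : -1 < β)
include hβ

lemma regDet_zero {n : ℕ} {a : Fin n → ℝ} (ha : ∀ i, ∀ m : ℤ, a i ≠ m) :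
    regDet β a 0 = betaDet n (β + 1) (Complex.ofReal ∘ a) := by
  rw [regDet, betaDet]
  congr 1
  ext i j
  have hij (m : ℤ) : a i + (j : ℕ) ≠ m := add_intCast_ne_intCast (ha i) (j : ℕ) m
  rw [regMatrix, Matrix.of_apply, regPart_zero hβ hij]
  simp

lemma hasDerivAt_regDet {n : ℕ} {a : Fin n → ℝ} (ha : ∀ i, ∀ m : ℤ, a i ≠ m) (t : ℂ) :
    HasDerivAt (regDet β a) (-∑ i, regDet β (Function.update a i (a i - 1)) t) t := by
  refine (hasDerivAt_det (M := regMatrix β a)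
    (M' := Matrix.of fun i j : Fin n => -regPart β (a i + (j : ℕ) - 1) t)
    fun i j => hasDerivAt_regPart hβ (add_intCast_ne_intCast (ha i) (j : ℕ)) t).congr_deriv ?_
  rw [← Finset.sum_neg_distrib]
  refine Finset.sum_congr rfl fun i _ => ?_
  have hrow : (Matrix.of fun i j : Fin n => -regPart β (a i + (j : ℕ) - 1) t) i =
      (-1 : ℂ) • fun j : Fin n => regPart β (a i - 1 + (j : ℕ)) t := by
    ext j
    simp only [Matrix.of_apply, Pi.smul_apply, smul_eq_mul, neg_one_mul, sub_add_eq_add_sub]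
  rw [hrow, Matrix.det_updateRow_smul, neg_one_mul, regDet]
  congr 2
  ext k j
  rw [Matrix.updateRow_apply, regMatrix, regMatrix, Matrix.of_apply, Matrix.of_apply,
    Function.update_apply]
  split_ifs <;> rfl

lemma hasDerivAt_regDet_cons {n : ℕ} {x : ℝ} {v : Fin n → ℝ} (hx : ∀ m : ℤ, x ≠ m)
    (hv : ∀ i, ∀ m : ℤ, v i ≠ m) (t : ℂ) :
    HasDerivAt (regDet β (Fin.cons x v)) (-(regDet β (Fin.cons (x - 1) v) t +
      ∑ i, regDet β (Fin.cons x (Function.update v i (v i - 1))) t)) t := by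
  refine (hasDerivAt_regDet hβ (Fin.cases hx hv) t).congr_deriv ?_
  simp only [Fin.sum_univ_succ, Fin.cons_zero, Fin.cons_succ, Fin.update_cons_zero,
    Fin.cons_update]

/-- Lowering any other row of an arithmetic progression makes it equal to its predecessor. -/
lemma hasDerivAt_regDet_arith (n : ℕ) {a : ℝ} (ha : ∀ m : ℤ, a ≠ m) (t : ℂ) :
    HasDerivAt (regDet β (arith a (n + 1)))
      (-regDet β (Fin.cons (a - 1) (arith (a + 1) n)) t) t := by
  have ha' (m : ℤ) : a + 1 ≠ m := by simpa using add_intCast_ne_intCast ha 1 m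
  rw [← cons_arith]
  refine (hasDerivAt_regDet_cons hβ ha (arith_ne_intCast ha') t).congr_deriv ?_
  rw [Finset.sum_eq_zero, add_zero]
  intro i _
  obtain _ | n := n
  · exact i.elim0
  refine Fin.cases ?_ (fun i => regDet_cons_update_arith_eq_zero β a (a + 1) i t) i
  exact regDet_eq_zero β (i := 0) (k := Fin.succ 0) (Fin.succ_ne_zero 0).symm (by simp [arith]) t

lemma regDet_arith_zero_eq_betaDet (n : ℕ) {a : ℝ} (ha : ∀ m : ℤ, a ≠ m) :
    regDet β (arith a n) 0 = betaDet n (β + 1) (arith (a : ℂ) n) := by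
  rw [regDet_zero hβ (arith_ne_intCast ha), ofReal_comp_arith]

lemma regDet_arith_zero (n : ℕ) {α : ℝ} (hα : -1 < α) (hα' : ∀ m : ℤ, α ≠ m) :
    regDet β (arith (α + 1) n) 0 = jacobiHankel n α β := by
  rw [regDet_arith_zero_eq_betaDet hβ n fun m => by simpa using add_intCast_ne_intCast hα' 1 m,
    ← betaDet_arith n (ofReal_add_one_add_natCast_ne_zero hα)
      (ofReal_add_one_add_natCast_ne_zero hβ)]
  push_cast
  rfl

lemma regDet_cons_arith_zero (n m : ℕ) {a : ℝ} (ha : ∀ m : ℤ, a ≠ m) :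
    regDet β (Fin.cons (a - m) (arith (a + 1) n)) 0 =
      regDet β (arith a (n + 1)) 0 * ((m + n).choose n *
        (ascPochhammer ℂ m).eval ((a : ℂ) - m + (β + 1) + n) /
          (ascPochhammer ℂ m).eval ((a : ℂ) - m)) := by
  have hsub (k : ℤ) : a - m ≠ k := by
    simpa [sub_eq_add_neg] using add_intCast_ne_intCast ha (-m) k
  have hadd (k : ℤ) : a + 1 ≠ k := by simpa using add_intCast_ne_intCast ha 1 k
  rw [regDet_arith_zero_eq_betaDet hβ _ ha, regDet_zero hβ (Fin.cases hsub (arith_ne_intCast hadd)),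
    Fin.comp_cons, ofReal_comp_arith]
  exact_mod_cast betaDet_cons_arith_lower n m (β + 1) (y := a) fun k => by
    exact_mod_cast ofReal_add_natCast_ne_zero hsub k

lemma sum_regDet_cons_update_arith_zero (n : ℕ) {a : ℝ} (ha : ∀ m : ℤ, a ≠ m) :
    ∑ i, regDet β (Fin.cons (a - 1) (Function.update (arith (a + 1) n) i
        (arith (a + 1) n i - 1))) 0 =
      regDet β (arith a (n + 1)) 0 *
        ((n + 1) * n * (a + β + n) * (a + β + n + 1) / (2 * (a - 1) * a)) := by
  obtain _ | n := n
  · simp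
  have hsub (k : ℤ) : a - 1 ≠ k := by
    simpa [sub_eq_add_neg] using add_intCast_ne_intCast ha (-1) k
  have hadd (k : ℤ) : a + 2 ≠ k := by simpa using add_intCast_ne_intCast ha 2 k
  have hrow : Function.update (arith (a + 1) (n + 1)) 0 (arith (a + 1) (n + 1) 0 - 1) =
      Fin.cons a (arith (a + 2) n) := by
    rw [← cons_arith, Fin.cons_zero, Fin.update_cons_zero, add_sub_cancel_right, add_assoc,
      one_add_one_eq_two]
  rw [Fin.sum_univ_succ, Finset.sum_eq_zero fun i _ =>
    regDet_cons_update_arith_eq_zero β (a - 1) (a + 1) i 0, add_zero, hrow,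
    regDet_arith_zero_eq_betaDet hβ _ ha,
    regDet_zero hβ (Fin.cases hsub (Fin.cases ha (arith_ne_intCast hadd))), Fin.comp_cons,
    Fin.comp_cons, ofReal_comp_arith]
  have hlower := betaDet_cons_cons_arith_lower n (β + 1) (y := a) fun k => by
    exact_mod_cast ofReal_add_natCast_ne_zero hsub k
  rw [ascPochhammer_two_eval, ascPochhammer_two_eval, cast_choose_two_add, sub_add_cancel] at hlower
  push_cast
  rw [hlower]
  simp only [div_eq_mul_inv, mul_inv]
  ring

lemma regDet_taylor (n : ℕ) {α : ℝ} (hα : -1 < α) (hα' : ∀ m : ℤ, α ≠ m) :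
    (fun t : ℂ => regDet β (arith (α + 1) (n + 1)) t / jacobiHankel (n + 1) α β -
      (1 - ((n + 1 : ℕ) * ((n + 1 : ℕ) + α + β) : ℂ) * t / α
        + ((n + 1 : ℕ) * ((n + 1 : ℕ) + α + β) * ((n + 1 : ℕ) * ((n + 1 : ℕ) + α + β) * α + β) : ℂ)
          * t ^ 2 / (2 * α * (α ^ 2 - 1)))) =O[𝓝 0] fun t : ℂ => t ^ 3 := by
  have hadd (m : ℤ) : α + 1 ≠ m := by simpa using add_intCast_ne_intCast hα' 1 m
  have hsub (m : ℤ) : α + 1 - 1 ≠ m := by simpa using hα' m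
  have hadd₂ (m : ℤ) : α + 1 + 1 ≠ m := by simpa using add_intCast_ne_intCast hadd 1 m
  have hα₀ : (α : ℂ) ≠ 0 := by simpa using ofReal_add_natCast_ne_zero hα' 0
  have hα₁ : (α : ℂ) + 1 ≠ 0 := by exact_mod_cast ofReal_add_natCast_ne_zero hα' 1
  have hα₂ : (α : ℂ) - 1 ≠ 0 := by
    have := hα' 1
    exact_mod_cast sub_ne_zero.2 this
  have hD : jacobiHankel (n + 1) α β ≠ 0 := jacobiHankel_ofReal_ne_zero n hα hβ
  have hfirst := regDet_cons_arith_zero hβ n 1 hadd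
  have hsecond := regDet_cons_arith_zero hβ n 2 hadd
  have hpair := sum_regDet_cons_update_arith_zero hβ n hadd
  rw [ascPochhammer_two_eval, ascPochhammer_two_eval, cast_choose_two_add] at hsecond
  rw [ascPochhammer_one, Polynomial.eval_X, Polynomial.eval_X, add_comm 1 n,
    Nat.choose_succ_self_right] at hfirst
  have hT := isBigO_sub_taylor_two (hasDerivAt_regDet_arith hβ n hadd)
    fun t => (hasDerivAt_regDet_cons hβ hsub (arith_ne_intCast hadd₂) t).fun_neg
  rw [regDet_arith_zero hβ (n + 1) hα hα'] at hfirst hsecond hpair hT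
  refine (hT.const_mul_left (jacobiHankel (n + 1) α β)⁻¹).congr_left fun t => ?_
  push_cast at hfirst hsecond hpair ⊢
  simp only [add_sub_cancel_right] at hfirst hpair
  rw [show (α : ℂ) + 1 - 2 = α - 1 by ring, sub_add_cancel] at hsecond
  rw [sub_sub, one_add_one_eq_two, hsecond, add_sub_cancel_right, hfirst, hpair,
    show (α : ℂ) ^ 2 - 1 = (α - 1) * (α + 1) by ring]
  field_simp
  ring

end

/-! ### The coefficient of the nonanalytic term -/

lemma Gamma_add_one_add_natCast {β : ℝ} (hβ : -1 < β) (n : ℕ) :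
    Real.Gamma (β + 1 + n) = (∏ j ∈ Finset.Icc 1 n, (β + j)) * Real.Gamma (β + 1) := by
  induction n with
  | zero => simp
  | succ n ih =>
    have hpos : 0 < β + 1 + n := add_pos_of_pos_of_nonneg (by linarith) n.cast_nonneg
    rw [Finset.prod_Icc_succ_top n.succ_pos, Nat.cast_succ, ← add_assoc,
      Real.Gamma_add_one hpos.ne', ih]
    ring

lemma Gamma_neg_mul_eq_nonanalyticCoeff (n : ℕ) {α β : ℝ} (hα : -1 < α) (hβ : -1 < β) :
    Real.Gamma (-(α + 1)) * (Real.Gamma (α + n + 2) * Real.Gamma (α + β + n + 2) /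
      (n.factorial * Real.Gamma (β + 1 + n) * Real.Gamma (α + 1) * Real.Gamma (α + 2))) =
      nonanalyticCoeff (n + 1) α β := by
  have hreflect : Real.Gamma (-(α + 1)) * Real.Gamma (α + 2) =
      Real.pi / Real.sin (α * Real.pi) := by
    have h := Real.Gamma_mul_Gamma_one_sub (-(α + 1))
    rwa [show 1 - -(α + 1) = α + 2 by ring,
      show Real.pi * -(α + 1) = -(α * Real.pi + Real.pi) by ring, Real.sin_neg,
      Real.sin_add_pi, neg_neg] at h
  have hGamma : Real.Gamma (α + 2) ≠ 0 := (Real.Gamma_pos_of_pos (by linarith)).ne'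
  rw [eq_div_of_mul_eq hGamma hreflect, nonanalyticCoeff, Gamma_add_one_add_natCast hβ,
    Nat.add_sub_cancel, show ((n + 1 : ℕ) : ℝ) + α + 1 = α + n + 2 by push_cast; ring,
    show ((n + 1 : ℕ) : ℝ) + 1 + α + β = α + β + n + 2 by push_cast; ring]
  simp only [div_eq_mul_inv, mul_inv]
  ring

lemma Gamma_neg_mul_jacobiHankel (n : ℕ) {α β : ℝ} (hα : -1 < α) (hβ : -1 < β) :
    Complex.Gamma (-(α + 1)) * jacobiHankel n (α + 2) β =
      jacobiHankel (n + 1) α β * nonanalyticCoeff (n + 1) α β := by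
  have hαβ (k : ℕ) : (α : ℂ) + β + n + 2 + k ≠ 0 := by
    have : 0 < α + β + n + 2 + k := by
      linarith [(Nat.cast_nonneg n : (0 : ℝ) ≤ n), (Nat.cast_nonneg k : (0 : ℝ) ≤ k)]
    exact_mod_cast this.ne'
  rw [jacobiHankel_add_two (ofReal_add_one_add_natCast_ne_zero hα)
    (ofReal_add_one_add_natCast_ne_zero hβ) hαβ, ← Gamma_neg_mul_eq_nonanalyticCoeff n hα hβ]
  push_cast [← Complex.Gamma_ofReal]
  ring

lemma nonanalyticCoeff_ne_zero (n : ℕ) {α β : ℝ} (hα : -1 < α) (hβ : -1 < β)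
    (hα' : ∀ m : ℤ, α ≠ m) : nonanalyticCoeff (n + 1) α β ≠ 0 := by
  have hsin : Real.sin (α * Real.pi) ≠ 0 := fun h => by
    obtain ⟨m, hm⟩ := Real.sin_eq_zero_iff.1 h
    exact hα' m (mul_right_cancel₀ Real.pi_ne_zero hm).symm
  have : (0 : ℝ) ≤ n := n.cast_nonneg
  have hprod : ∏ j ∈ Finset.Icc 1 n, (β + j) ≠ 0 := by
    refine (Finset.prod_pos fun j hj => ?_).ne'
    have : (1 : ℝ) ≤ j := by exact_mod_cast (Finset.mem_Icc.1 hj).1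
    linarith
  have hGamma {x : ℝ} (hx : 0 < x) : Real.Gamma x ≠ 0 := (Real.Gamma_pos_of_pos hx).ne'
  rw [nonanalyticCoeff, Nat.add_sub_cancel]
  push_cast
  exact div_ne_zero
    (mul_ne_zero (mul_ne_zero (hGamma (by linarith)) (hGamma (by linarith))) Real.pi_ne_zero)
    (mul_ne_zero (mul_ne_zero (mul_ne_zero (mul_ne_zero (mul_ne_zero (hGamma (by linarith))
      (hGamma (by linarith))) (pow_ne_zero 2 (hGamma (by linarith)))) hsin)
      (Nat.cast_ne_zero.2 n.factorial_ne_zero)) hprod)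

/-! ### Expansion of the Hankel determinant -/

/-- The matrix with the rows of `Y` in `s` and the rows of `X` elsewhere. -/
def rowPiecewise {R ι : Type*} [DecidableEq ι] (s : Finset ι) (Y X : Matrix ι ι R) :
    Matrix ι ι R :=
  Matrix.of fun i j => if i ∈ s then Y i j else X i j

lemma det_add_smul_eq_sum {R ι : Type*} [CommRing R] [Fintype ι] [DecidableEq ι]
    (X Y : Matrix ι ι R) (u : R) :
    (X + u • Y).det = ∑ s : Finset ι, u ^ s.card * (rowPiecewise s Y X).det := by
  let det := (Matrix.detRowAlternating (n := ι) (R := R)).toMultilinearMap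
  calc (X + u • Y).det = det ((fun i => u • Y.row i) + X.row) := by rw [add_comm]; rfl
    _ = ∑ s : Finset ι, det (s.piecewise (fun i => u • Y.row i) X.row) := det.map_add_univ _ _
    _ = _ := Finset.sum_congr rfl fun s _ => ?_
  have hsmul := det.map_piecewise_smul (fun _ => u) (rowPiecewise s Y X).row s
  rw [Finset.prod_const, smul_eq_mul] at hsmul
  refine Eq.trans (congrArg det (funext fun i => ?_)) hsmul
  by_cases hi : i ∈ s <;> ext j <;> simp [hi, rowPiecewise]

lemma sum_finset_eq_add_add {ι M : Type*} [Fintype ι] [AddCommMonoid M]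
    (f : Finset ι → M) : ∑ s, f s = f ∅ + ∑ i, f {i} + ∑ s with 2 ≤ s.card, f s := by
  classical
  have hsmall : (Finset.univ.filter fun s : Finset ι => ¬2 ≤ s.card) =
      insert ∅ (Finset.univ.image ({·} : ι → Finset ι)) := by
    ext s
    have hcard : ¬2 ≤ s.card ↔ s.card = 0 ∨ s.card = 1 := by omega
    simp only [Finset.mem_filter, Finset.mem_univ, true_and, Finset.mem_insert, Finset.mem_image,
      hcard, Finset.card_eq_zero, Finset.card_eq_one, eq_comm]
  rw [← Finset.sum_filter_add_sum_filter_not Finset.univ fun s : Finset ι => 2 ≤ s.card, add_comm,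
    hsmall, Finset.sum_insert (by simp), Finset.sum_image Finset.singleton_injective.injOn]

lemma isBigO_cpow_pow {r q : ℝ} {k : ℕ} (hq : 0 ≤ q) (h : q ≤ r * k) :
    (fun t : ℂ => (t ^ (r : ℂ)) ^ k) =O[𝓝 0] fun t => ‖t‖ ^ q := by
  refine IsBigO.of_bound 1 ?_
  filter_upwards [Metric.ball_mem_nhds (0 : ℂ) one_pos] with t ht
  rw [norm_pow, Complex.norm_cpow_real, one_mul, ← Real.rpow_mul_natCast (norm_nonneg t),
    Real.norm_of_nonneg (Real.rpow_nonneg (norm_nonneg t) q)]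
  exact Real.rpow_le_rpow_of_exponent_ge' (norm_nonneg t) (mem_ball_zero_iff.1 ht).le hq h

lemma arith_add_pos {x : ℝ} (hx : 0 < x) {n : ℕ} (i : Fin n) (j : ℕ) : 0 < arith x n i + j := by
  rw [arith]
  positivity

lemma hankelD_eq_det_pjInt (n : ℕ) (t : ℂ) (α β : ℝ) :
    hankelD n t α β =
      (Matrix.of fun i j : Fin n => pjInt β (arith (α + 1) n i + (j : ℕ)) t).det := by
  rw [hankelD]
  congr 1
  ext i j
  rw [Matrix.of_apply, Matrix.of_apply, pjMoment_eq_pjInt, arith, Nat.cast_add, add_assoc (α + 1)]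

/-- The matrix of the factors of `t ^ (α + 1)` in the moments `μ_{i+j}(t)`. -/
def singMatrix (n : ℕ) (α β : ℝ) (t : ℂ) : Matrix (Fin n) (Fin n) ℂ :=
  Matrix.of fun i j => t ^ ((i : ℕ) + (j : ℕ)) * singPart β (arith (α + 1) n i + (j : ℕ)) t

/-- The determinant whose rows in `s` are singular and whose other rows are regular. -/
def mixedDet (n : ℕ) (α β : ℝ) (s : Finset (Fin n)) (t : ℂ) : ℂ :=
  (rowPiecewise s (singMatrix n α β t) (regMatrix β (arith (α + 1) n) t)).det

/-- The analytic continuation of `t ↦ hankelD n t α β` to the slit plane. -/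
def hankelContinuation (n : ℕ) (α β : ℝ) (t : ℂ) : ℂ :=
  (regMatrix β (arith (α + 1) n) t + t ^ ((α : ℂ) + 1) • singMatrix n α β t).det

/-- The power series part `A` of `D_n(t) / D_n(0)`. -/
def analyticPart (n : ℕ) (α β : ℝ) (t : ℂ) : ℂ :=
  regDet β (arith (α + 1) n) t / jacobiHankel n α β

/-- The factor `B` of the nonanalytic term of `D_n(t) / D_n(0)`: exactly one row is singular. -/
def singularPart (n : ℕ) (α β : ℝ) (t : ℂ) : ℂ :=
  (∑ i, mixedDet n α β {i} t) / (jacobiHankel n α β * nonanalyticCoeff n α β)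

/-- The remainder of `D_n(t) / D_n(0)`: at least two rows are singular. -/
def expansionRemainder (n : ℕ) (α β : ℝ) (t : ℂ) : ℂ :=
  (∑ s with 2 ≤ s.card, (t ^ ((α : ℂ) + 1)) ^ s.card * mixedDet n α β s t) / jacobiHankel n α β

lemma mixedDet_empty (n : ℕ) (α β : ℝ) (t : ℂ) :
    mixedDet n α β ∅ t = regDet β (arith (α + 1) n) t := by
  simp only [mixedDet, regDet, rowPiecewise, Finset.notMem_empty, if_false]
  rfl

lemma mixedDet_singleton_zero_of_ne {n : ℕ} (α β : ℝ) {i : Fin (n + 1)} (hi : i ≠ 0) :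
    mixedDet (n + 1) α β {i} 0 = 0 := by
  refine Matrix.det_eq_zero_of_row_eq_zero i fun j => ?_
  have hij : (i : ℕ) + (j : ℕ) ≠ 0 := by
    have := Fin.val_ne_of_ne hi
    rw [Fin.val_zero] at this
    omega
  rw [rowPiecewise, Matrix.of_apply, if_pos (Finset.mem_singleton_self i), singMatrix,
    Matrix.of_apply, zero_pow hij, zero_mul]

section

variable {n : ℕ} {α β : ℝ} (hα : -1 < α) (hβ : -1 < β)
include hα hβ

lemma ofReal_add_add_one_add_natCast_ne_zero (hαβ : α + β ≠ -1) (k : ℕ) :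
    (α : ℂ) + β + 1 + k ≠ 0 := by
  obtain _ | k := k
  · have : α + β + 1 + (0 : ℕ) ≠ 0 := by simpa [add_eq_zero_iff_eq_neg] using hαβ
    exact_mod_cast this
  · have : 0 < α + β + 1 + (k + 1 : ℕ) := by
      push_cast
      linarith [(Nat.cast_nonneg k : (0 : ℝ) ≤ k)]
    exact_mod_cast this.ne'

lemma hankelD_zero : hankelD n 0 α β = jacobiHankel n α β := by
  rw [hankelD_eq_det_pjInt, ← betaDet_arith n (ofReal_add_one_add_natCast_ne_zero hα)
    (ofReal_add_one_add_natCast_ne_zero hβ), betaDet]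
  congr 1
  ext i j
  rw [Matrix.of_apply, Matrix.of_apply,
    pjInt_zero hβ (arith_add_pos (neg_lt_iff_pos_add.1 hα) i j), arith, arith]
  push_cast
  rfl

variable (hα' : ∀ m : ℤ, α ≠ m)
include hα'

omit hα hβ in
lemma arith_add_one_add_ne_intCast (i : Fin n) (j : ℕ) (m : ℤ) : arith (α + 1) n i + j ≠ m :=
  add_intCast_ne_intCast
    (arith_ne_intCast (fun m => by simpa using add_intCast_ne_intCast hα' 1 m) i) j m

lemma differentiable_mixedDet (s : Finset (Fin n)) : Differentiable ℂ (mixedDet n α β s) := by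
  refine fun t => differentiableAt_det fun i j => ?_
  by_cases hi : i ∈ s
  · simp only [rowPiecewise, hi, if_true, singMatrix, Matrix.of_apply]
    exact ((differentiable_id.pow _).mul
      (differentiable_singPart hβ (arith_add_pos (neg_lt_iff_pos_add.1 hα) i j))) t
  · simp only [rowPiecewise, hi, if_false, regMatrix, Matrix.of_apply]
    exact differentiable_regPart hβ (arith_add_one_add_ne_intCast hα' i j) t

lemma differentiableOn_hankelContinuation :
    DifferentiableOn ℂ (hankelContinuation n α β) Complex.slitPlane := by
  refine fun t ht => (differentiableAt_det fun i j => ?_).differentiableWithinAt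
  simp only [Matrix.add_apply, Matrix.smul_apply, regMatrix, singMatrix, Matrix.of_apply]
  exact (differentiable_regPart hβ (arith_add_one_add_ne_intCast hα' i j) t).add
    ((differentiableAt_id.cpow (differentiableAt_const _) ht).smul (((differentiable_id.pow _).mul
      (differentiable_singPart hβ (arith_add_pos (neg_lt_iff_pos_add.1 hα) i j))) t))

lemma hankelContinuation_eq_hankelD {t : ℂ} (ht : 0 ≤ t.re) (ht' : t ∈ Complex.slitPlane) :
    hankelContinuation n α β t = hankelD n t α β := by
  rw [hankelD_eq_det_pjInt, hankelContinuation]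
  congr 1
  ext i j
  have hexp : ((arith (α + 1) n i + (j : ℕ) : ℝ) : ℂ) =
      (α + 1) + (((i : ℕ) + (j : ℕ) : ℕ) : ℂ) := by
    rw [arith]
    push_cast
    ring
  simp only [Matrix.add_apply, Matrix.smul_apply, regMatrix, singMatrix, Matrix.of_apply,
    smul_eq_mul]
  rw [pjInt_eq hβ (arith_add_pos (neg_lt_iff_pos_add.1 hα) i j)
    (arith_add_one_add_ne_intCast hα' i j) ht ht', hexp,
    Complex.cpow_add (α + 1 : ℂ) _ (Complex.slitPlane_ne_zero ht'), Complex.cpow_natCast,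
    mul_assoc]

lemma mixedDet_singleton_zero :
    mixedDet (n + 1) α β {0} 0 = jacobiHankel (n + 1) α β * nonanalyticCoeff (n + 1) α β := by
  set M := rowPiecewise {0} (singMatrix (n + 1) α β 0) (regMatrix β (arith (α + 1) (n + 1)) 0)
    with hM
  have hcorner : M 0 0 = Complex.Gamma (-(α + 1)) := by
    simp [hM, rowPiecewise, singMatrix, arith, singPart_zero]
  have hrow (j : Fin n) : M 0 j.succ = 0 := by
    simp [hM, rowPiecewise, singMatrix]
  have hminor : (M.submatrix Fin.succ Fin.succ).det = jacobiHankel n (α + 2) β := by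
    have hα₂ (m : ℤ) : α + 2 ≠ m := by simpa using add_intCast_ne_intCast hα' 2 m
    have := regDet_arith_zero hβ n (by linarith : -1 < α + 2) hα₂
    push_cast at this
    rw [← this, regDet]
    congr 1
    ext i j
    simp only [hM, Matrix.submatrix_apply, rowPiecewise, Matrix.of_apply, Finset.mem_singleton,
      Fin.succ_ne_zero, if_false, regMatrix, arith, Fin.val_succ]
    congr 1
    push_cast
    ring
  rw [mixedDet, ← hM, Matrix.det_succ_row_zero, Fin.sum_univ_succ,
    Finset.sum_eq_zero fun j _ => by rw [hrow, mul_zero, zero_mul], add_zero, hcorner,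
    Fin.succAbove_zero, hminor, Fin.val_zero, pow_zero, one_mul,
    Gamma_neg_mul_jacobiHankel n hα hβ]

lemma sum_mixedDet_singleton_zero :
    ∑ i, mixedDet (n + 1) α β {i} 0 =
      jacobiHankel (n + 1) α β * nonanalyticCoeff (n + 1) α β := by
  rw [← mixedDet_singleton_zero hα hβ hα', Finset.sum_eq_single 0
    (fun i _ hi => mixedDet_singleton_zero_of_ne α β hi) (absurd (Finset.mem_univ _))]

lemma differentiable_analyticPart : Differentiable ℂ (analyticPart n α β) := by
  have := differentiable_mixedDet hα hβ hα' (∅ : Finset (Fin n))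
  rw [funext (mixedDet_empty n α β)] at this
  exact this.div_const _

lemma differentiable_singularPart : Differentiable ℂ (singularPart n α β) :=
  (Differentiable.fun_sum fun i _ => differentiable_mixedDet hα hβ hα' {i}).div_const _

lemma isBigO_singularPart_sub_one :
    (fun t => singularPart (n + 1) α β t - 1) =O[𝓝 0] fun t => t := by
  have hzero : singularPart (n + 1) α β 0 = 1 := by
    rw [singularPart, sum_mixedDet_singleton_zero hα hβ hα']
    exact div_self (mul_ne_zero (jacobiHankel_ofReal_ne_zero n hα hβ)
      (Complex.ofReal_ne_zero.2 (nonanalyticCoeff_ne_zero n hα hβ hα')))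
  simpa only [hzero, sub_zero] using
    (differentiable_singularPart (n := n + 1) hα hβ hα' 0).isBigO_sub

lemma isBigO_expansionRemainder :
    expansionRemainder n α β =O[𝓝 0] fun t : ℂ => ‖t‖ ^ (2 * (α + 1)) := by
  unfold expansionRemainder
  simp only [div_eq_inv_mul]
  refine (IsBigO.fun_sum fun s hs => ?_).const_mul_left _
  have hcard : (2 : ℝ) ≤ s.card := by exact_mod_cast (Finset.mem_filter.1 hs).2
  have hpow := isBigO_cpow_pow (r := α + 1) (q := 2 * (α + 1)) (k := s.card) (by linarith)
    (by rw [mul_comm]; exact mul_le_mul_of_nonneg_left hcard (by linarith))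
  have hbdd := (differentiable_mixedDet hα hβ hα' s 0).continuousAt.isBigO_one ℝ
  simpa using hpow.mul hbdd

lemma hankelContinuation_eq (t : ℂ) :
    hankelContinuation (n + 1) α β t = hankelD (n + 1) 0 α β *
      (analyticPart (n + 1) α β t +
        nonanalyticCoeff (n + 1) α β * t ^ ((α : ℂ) + 1) * singularPart (n + 1) α β t +
        expansionRemainder (n + 1) α β t) := by
  have hD := jacobiHankel_ofReal_ne_zero n hα hβ
  have hc := Complex.ofReal_ne_zero.2 (nonanalyticCoeff_ne_zero n hα hβ hα')
  rw [hankelD_zero hα hβ, hankelContinuation, det_add_smul_eq_sum, sum_finset_eq_add_add]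
  simp only [Finset.card_empty, Finset.card_singleton, pow_zero, pow_one, one_mul,
    ← Finset.mul_sum, analyticPart, singularPart, expansionRemainder, ← mixedDet_empty, mixedDet]
  field_simp

end

end

theorem theorem7_general (n : ℕ) (hn : 1 ≤ n) (α β : ℝ) (hα : -1 < α) (hβ : -1 < β) :
    ((∀ m : ℤ, α ≠ (m : ℝ)) →
      ∃ D A B R : ℂ → ℂ,
        DifferentiableOn ℂ D Complex.slitPlane ∧
        (∀ t ∈ Complex.slitPlane, 0 ≤ t.re → D t = hankelD n t α β) ∧
        AnalyticAt ℂ A 0 ∧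
        AnalyticAt ℂ B 0 ∧
        (fun t : ℂ => A t -
            (1 - (n * (n + α + β) : ℂ) * t / α
              + (n * (n + α + β) * (n * (n + α + β) * α + β) : ℂ) * t ^ 2
                  / (2 * α * (α ^ 2 - 1))))
          =O[𝓝 0] (fun t : ℂ => t ^ 3) ∧
        (fun t : ℂ => B t - 1) =O[𝓝 0] (fun t : ℂ => t) ∧
        R =O[𝓝[Complex.slitPlane] 0] (fun t : ℂ => ‖t‖ ^ (2 * (α + 1))) ∧
        ∀ᶠ t in 𝓝[Complex.slitPlane] (0 : ℂ),
          D t = hankelD n 0 α β *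
            (A t + (nonanalyticCoeff n α β : ℂ) * t ^ ((α : ℂ) + 1) * B t + R t)) ∧
    (α + β ≠ -1 → hankelD n 0 α β =
      (4 : ℂ) ^ (-((n : ℂ) * (n + α + β))) * (2 * (Real.pi : ℂ)) ^ n
        * (Complex.Gamma ((α + β + 1) / 2) * barnesG ((α + β + 1) / 2) ^ 2
            * barnesG ((α + β) / 2 + 1) ^ 2
          / (barnesG (α + β + 1) * barnesG (α + 1) * barnesG (β + 1)))
        * (barnesG (n + 1) * barnesG (n + α + 1) * barnesG (n + β + 1) * barnesG (n + α + β + 1)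
          / (barnesG (n + (α + β + 1) / 2) ^ 2 * barnesG (n + 1 + (α + β) / 2) ^ 2
            * Complex.Gamma (n + (α + β + 1) / 2)))) := by
  obtain ⟨n, rfl⟩ := Nat.exists_eq_add_of_le' hn
  refine ⟨fun hα' => ⟨hankelContinuation (n + 1) α β, analyticPart (n + 1) α β,
    singularPart (n + 1) α β, expansionRemainder (n + 1) α β,
    differentiableOn_hankelContinuation hα hβ hα',
    fun t ht' ht => hankelContinuation_eq_hankelD hα hβ hα' ht ht',
    (differentiable_analyticPart hα hβ hα').analyticAt 0,
    (differentiable_singularPart hα hβ hα').analyticAt 0,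
    regDet_taylor hβ n hα hα', isBigO_singularPart_sub_one hα hβ hα',
    (isBigO_expansionRemainder hα hβ hα').mono nhdsWithin_le_nhds,
    Eventually.of_forall (hankelContinuation_eq hα hβ hα')⟩, fun hαβ => ?_⟩
  exact (hankelD_zero hα hβ).trans (jacobiHankel_eq_barnesG
    (ofReal_add_one_add_natCast_ne_zero hα) (ofReal_add_one_add_natCast_ne_zero hβ)
    (ofReal_add_add_one_add_natCast_ne_zero hα hβ hαβ) (n + 1))

theorem theorem7 (n : ℕ) (hn : 1 ≤ n) (α β : ℝ) (hα : 0 < α) (hβ : 0 < β) :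
    ((∀ m : ℤ, α ≠ (m : ℝ)) →
      ∃ D A B R : ℂ → ℂ,
        -- `D` is the analytic continuation of `t ↦ D_n(t, α, β)` to `|arg t| < π`
        DifferentiableOn ℂ D Complex.slitPlane ∧
        (∀ t ∈ Complex.slitPlane, 0 ≤ t.re → D t = hankelD n t α β) ∧
        -- the power series part `A`, the series `B` multiplying `t^{α+1}`, and the remainder `R`
        AnalyticAt ℂ A 0 ∧
        AnalyticAt ℂ B 0 ∧
        (fun t : ℂ => A t -
            (1 - (n * (n + α + β) : ℂ) * t / α
              + (n * (n + α + β) * (n * (n + α + β) * α + β) : ℂ) * t ^ 2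
                  / (2 * α * (α ^ 2 - 1))))
          =O[𝓝 0] (fun t : ℂ => t ^ 3) ∧
        (fun t : ℂ => B t - 1) =O[𝓝 0] (fun t : ℂ => t) ∧
        R =O[𝓝[Complex.slitPlane] 0] (fun t : ℂ => ‖t‖ ^ (2 * (α + 1))) ∧
        ∀ᶠ t in 𝓝[Complex.slitPlane] (0 : ℂ),
          D t = hankelD n 0 α β *
            (A t + (nonanalyticCoeff n α β : ℂ) * t ^ ((α : ℂ) + 1) * B t + R t)) ∧
    hankelD n 0 α β =
      (4 : ℂ) ^ (-((n : ℂ) * (n + α + β))) * (2 * (Real.pi : ℂ)) ^ n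
        * (Complex.Gamma ((α + β + 1) / 2) * barnesG ((α + β + 1) / 2) ^ 2
            * barnesG ((α + β) / 2 + 1) ^ 2
          / (barnesG (α + β + 1) * barnesG (α + 1) * barnesG (β + 1)))
        * (barnesG (n + 1) * barnesG (n + α + 1) * barnesG (n + β + 1) * barnesG (n + α + β + 1)
          / (barnesG (n + (α + β + 1) / 2) ^ 2 * barnesG (n + 1 + (α + β) / 2) ^ 2
            * Complex.Gamma (n + (α + β + 1) / 2))) :=
  (theorem7_general n hn α β (by linarith) (by linarith)).imp_right fun h => h (by linarith)
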